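/- All rings have an identity. For a ring $R$ that is noetherian on both sides and a positive integer $n$, let $\mathcal{E}_n(R_R)$ be the class of all finitely generated left $R$-modules that are isomorphic to $\mathrm{Ext}^n_{R^{op}}(N,R)$ for some finitely generated right $R$-module $N$, where the left $R$-module structure on $\mathrm{Ext}^n_{R^{op}}(N,R)$ comes from left multiplication on $R$. A class of left $R$-modules is called submodule-closed if every non-zero submodule of a module in the class is again in the class. Paths are composed like functions: $\beta\alpha$ means first $\alpha$, then $\beta$. Let $K$ be any field. (1) Let $R$ be the path algebra over $K$ of the quiver $2\longleftarrow 1\longrightarrow 3$. Then $R$ is a finite-dimensional $K$-algebra, it is noetherian on both sides, the injective dimensions of ${}_RR$ and of $R_R$ are both equal to $1$, the injective envelope $I_0$ of ${}_RR$ has flat dimension $1$, and $\mathcal{E}_1(R_R)$ is not submodule-closed. (2) Let $\Delta$ be the quiver with vertices $1,2,3,4$ and arrows $\alpha:1\to 2$, $\beta:2\to 4$, $\gamma:1\to 3$, $\delta:3\to 4$, and let $R=K\Delta/(\beta\alpha)$. Then $R$ is a finite-dimensional $K$-algebra, it is noetherian on both sides, the injective dimensions of ${}_RR$ and of $R_R$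 are both equal to $2$, the injective envelope of the indecomposable projective left module $P_4=Re_4$ corresponding to the vertex $4$ has flat dimension $2$, the injective envelope $I_0$ of ${}_RR$ has flat dimension $2$, and $\mathcal{E}_2(R_R)$ is not submodule-closed. (3) Consequently the following question of Auslander (1969) has a negative answer: for every two-sided noetherian ring $R$, is $\mathcal{E}_1(R_R)$ submodule-closed? -/

import Mathlib

open CategoryTheory MulOpposite
open scoped TensorProduct

universe u

noncomputable section

/-! ### Path algebras -/

/-- The path algebra of a quiver `V` over `K`: the free `K`-module on the set of all paths of `V`
(including the trivial path at every vertex). -/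
def PathAlgebra (K : Type u) (V : Type) [Quiver.{0} V] [Field K] : Type u :=
  (Σ a b : V, Quiver.Path a b) →₀ K

namespace PathAlgebra

theorem lift_single {K : Type*} [Field K] {P M : Type*} [AddCommGroup M] [Module K M] (φ : P → M) (p : P) :
    Finsupp.lift M K P φ (Finsupp.single p 1) = φ p := by
  simp

variable {K : Type u} {V : Type} [Quiver.{0} V] [Field K]

instance : AddCommGroup (PathAlgebra K V) :=
  inferInstanceAs (AddCommGroup ((Σ a b : V, Quiver.Path a b) →₀ K))

instance : Module K (PathAlgebra K V) :=
  inferInstanceAs (Module K ((Σ a b : V, Quiver.Path a b) →₀ K))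

variable (K) in
/-- A path, as a basis element of the path algebra. -/
def ofPath {a b : V} (p : Quiver.Path a b) : PathAlgebra K V :=
  Finsupp.single ⟨a, b, p⟩ 1

instance [Fintype V] : One (PathAlgebra K V) := ⟨∑ v : V, ofPath K (Quiver.Path.nil (a := v))⟩

theorem one_def [Fintype V] :
    (1 : PathAlgebra K V) = ∑ v : V, ofPath K (Quiver.Path.nil (a := v)) := rfl

/-- Two linear maps out of the path algebra agree if they agree on paths. -/
theorem hom_ext {M : Type*} [AddCommMonoid M] [Module K M] {f g : PathAlgebra K V →ₗ[K] M}
    (h : ∀ (a b : V) (p : Quiver.Path a b), f (ofPath K p) = g (ofPath K p)) : f = g :=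
  Finsupp.lhom_ext' fun p => LinearMap.ext_ring (h p.1 p.2.1 p.2.2)

variable [DecidableEq V]

variable (K) in
/-- The product `q * p` of two paths: `p` followed by `q` if `p` ends where `q` starts, and `0`
otherwise. (Arrows compose like functions, so that left modules are covariant representations
of the quiver.) -/
def pathMul (q p : Σ a b : V, Quiver.Path a b) : PathAlgebra K V :=
  if h : p.2.1 = q.1 then ofPath K (p.2.2.comp (q.2.2.cast h.symm rfl)) else 0

variable (K V) in
/-- The multiplication of the path algebra: the bilinear extension of `pathMul`. -/
def mulBilin : PathAlgebra K V →ₗ[K] PathAlgebra K V →ₗ[K] PathAlgebra K V :=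
  Finsupp.lift (PathAlgebra K V →ₗ[K] PathAlgebra K V) K (Σ a b : V, Quiver.Path a b) fun q =>
    Finsupp.lift (PathAlgebra K V) K (Σ a b : V, Quiver.Path a b) fun p => pathMul K q p

instance : Mul (PathAlgebra K V) := ⟨fun x y => mulBilin K V x y⟩

theorem mul_def (x y : PathAlgebra K V) : x * y = mulBilin K V x y := rfl

theorem mulBilin_ofPath {a b c d : V} (q : Quiver.Path c d) (p : Quiver.Path a b) :
    mulBilin K V (ofPath K q) (ofPath K p) = pathMul K ⟨c, d, q⟩ ⟨a, b, p⟩ := by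
  have h : mulBilin K V (ofPath K q) =
      Finsupp.lift (PathAlgebra K V) K (Σ a b : V, Quiver.Path a b) fun p =>
        pathMul K ⟨c, d, q⟩ p := lift_single _ _
  rw [h]
  exact lift_single _ _

theorem ofPath_mul_ofPath {a b d : V} (q : Quiver.Path b d) (p : Quiver.Path a b) :
    ofPath K q * ofPath K p = ofPath K (p.comp q) := by
  rw [mul_def, mulBilin_ofPath]; simp [pathMul]

theorem ofPath_mul_ofPath_of_ne {a b c d : V} (q : Quiver.Path c d) (p : Quiver.Path a b)
    (h : b ≠ c) : ofPath K q * ofPath K p = 0 := by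
  rw [mul_def, mulBilin_ofPath]; simp [pathMul, h]

protected theorem mul_assoc' (x y z : PathAlgebra K V) : x * y * z = x * (y * z) := by
  let L : PathAlgebra K V →ₗ[K] PathAlgebra K V →ₗ[K] PathAlgebra K V →ₗ[K] PathAlgebra K V :=
    (LinearMap.llcomp K (PathAlgebra K V) (PathAlgebra K V)
      (PathAlgebra K V →ₗ[K] PathAlgebra K V) (mulBilin K V)) ∘ₗ mulBilin K V
  let Q : PathAlgebra K V →ₗ[K] PathAlgebra K V →ₗ[K] PathAlgebra K V →ₗ[K] PathAlgebra K V :=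
    (LinearMap.lcomp K (PathAlgebra K V →ₗ[K] PathAlgebra K V) (mulBilin K V)) ∘ₗ
      (LinearMap.llcomp K (PathAlgebra K V) (PathAlgebra K V) (PathAlgebra K V)) ∘ₗ
        mulBilin K V
  have h : L = Q := by
    refine hom_ext fun a b p => hom_ext fun c d q => hom_ext fun e f r => ?_
    change ofPath K p * ofPath K q * ofPath K r = ofPath K p * (ofPath K q * ofPath K r)
    have z1 : ∀ t : PathAlgebra K V, 0 * t = 0 := fun t => by simp [mul_def]
    have z2 : ∀ t : PathAlgebra K V, t * 0 = 0 := fun t => by simp [mul_def]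
    by_cases h1 : d = a
    · subst h1
      by_cases h2 : f = c
      · subst h2
        simp only [ofPath_mul_ofPath, Quiver.Path.comp_assoc]
      · rw [ofPath_mul_ofPath, ofPath_mul_ofPath_of_ne _ _ h2, ofPath_mul_ofPath_of_ne _ _ h2, z2]
    · rw [ofPath_mul_ofPath_of_ne _ _ h1, z1]
      by_cases h2 : f = c
      · subst h2
        rw [ofPath_mul_ofPath, ofPath_mul_ofPath_of_ne _ _ h1]
      · rw [ofPath_mul_ofPath_of_ne _ _ h2, z2]
  exact congrArg (fun F => F x y z) h

variable [Fintype V]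

protected theorem one_mul' (x : PathAlgebra K V) : 1 * x = x := by
  have h : mulBilin K V 1 = LinearMap.id := by
    refine hom_ext fun a b p => ?_
    rw [one_def, map_sum, LinearMap.sum_apply, Finset.sum_eq_single b]
    · exact ofPath_mul_ofPath _ _
    · intro v _ hv
      exact ofPath_mul_ofPath_of_ne _ _ hv.symm
    · simp
  exact congrArg (fun F => F x) h

protected theorem mul_one' (x : PathAlgebra K V) : x * 1 = x := by
  have h : (mulBilin K V).flip 1 = LinearMap.id := by
    refine hom_ext fun a b p => ?_
    rw [LinearMap.flip_apply, one_def, map_sum, Finset.sum_eq_single a]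
    · refine (ofPath_mul_ofPath p (Quiver.Path.nil (a := a))).trans ?_
      rw [Quiver.Path.nil_comp]; rfl
    · intro v _ hv
      exact ofPath_mul_ofPath_of_ne _ _ hv
    · simp
  exact congrArg (fun F => F x) h

instance : Ring (PathAlgebra K V) :=
  { (inferInstance : AddCommGroup (PathAlgebra K V)) with
    mul := (· * ·)
    one := 1
    mul_assoc := PathAlgebra.mul_assoc'
    one_mul := PathAlgebra.one_mul'
    mul_one := PathAlgebra.mul_one'
    zero_mul := fun x => by simp [mul_def]
    mul_zero := fun x => by simp [mul_def]
    left_distrib := fun x y z => by simp [mul_def]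
    right_distrib := fun x y z => by simp [mul_def] }

instance : Algebra K (PathAlgebra K V) :=
  Algebra.ofModule (fun r x y => by simp [mul_def]) (fun r x y => by simp [mul_def])

end PathAlgebra

/-! ### The two algebras -/

/-- The vertices of the quiver `2 ⟵ 1 ⟶ 3`. -/
inductive SpanVertex : Type
  | v1 | v2 | v3
  deriving DecidableEq

instance : Fintype SpanVertex := ⟨{.v1, .v2, .v3}, fun v => by cases v <;> simp⟩

/-- The arrows of the quiver `2 ⟵ 1 ⟶ 3`. -/
inductive SpanArrow : SpanVertex → SpanVertex → Type
  | toTwo : SpanArrow .v1 .v2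
  | toThree : SpanArrow .v1 .v3

instance : Quiver.{0} SpanVertex := ⟨SpanArrow⟩

/-- The path algebra of the quiver `2 ⟵ 1 ⟶ 3`. -/
abbrev SpanAlgebra (K : Type u) [Field K] : Type u := PathAlgebra K SpanVertex

/-- The vertices of the square quiver. -/
inductive SquareVertex : Type
  | v1 | v2 | v3 | v4
  deriving DecidableEq

instance : Fintype SquareVertex := ⟨{.v1, .v2, .v3, .v4}, fun v => by cases v <;> simp⟩

/-- The arrows `α : 1 ⟶ 2`, `β : 2 ⟶ 4`, `γ : 1 ⟶ 3`, `δ : 3 ⟶ 4` of the square quiver. -/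
inductive SquareArrow : SquareVertex → SquareVertex → Type
  | α : SquareArrow .v1 .v2
  | β : SquareArrow .v2 .v4
  | γ : SquareArrow .v1 .v3
  | δ : SquareArrow .v3 .v4

instance : Quiver.{0} SquareVertex := ⟨SquareArrow⟩

/-- The path `1 ⟶ 2 ⟶ 4`, that is, `α` followed by `β`, as the product `β α` in the path algebra of
the square quiver. -/
def squareRelation (K : Type u) [Field K] : PathAlgebra K SquareVertex :=
  PathAlgebra.ofPath K (Quiver.Hom.toPath (V := SquareVertex) SquareArrow.β) *
    PathAlgebra.ofPath K (Quiver.Hom.toPath (V := SquareVertex) SquareArrow.α)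

/-- The two-sided ideal `(β α)` of the path algebra of the square quiver. -/
def squareIdeal (K : Type u) [Field K] : TwoSidedIdeal (PathAlgebra K SquareVertex) :=
  TwoSidedIdeal.span {squareRelation K}

/-- The algebra `K Δ / (β α)`, for the square quiver `Δ`. -/
abbrev SquareAlgebra (K : Type u) [Field K] : Type u := (squareIdeal K).ringCon.Quotient

/-- The indecomposable projective left module `P₄ = R e₄` of `R = K Δ / (β α)` that corresponds to
the vertex `4`, where `e₄` is the class of the trivial path at `4`. -/
def squareP4 (K : Type u) [Field K] : Submodule (SquareAlgebra K) (SquareAlgebra K) :=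
  Submodule.span (SquareAlgebra K)
    {(squareIdeal K).ringCon.mk'
      (PathAlgebra.ofPath K (Quiver.Path.nil (a := SquareVertex.v4)))}

/-! ### Flat modules and flat dimension over a noncommutative ring

A right `R`-module is a module over `Rᵐᵒᵖ`. -/

section Flat

variable (R : Type u) [Ring R]

/-- The relations `(a r) ⊗ m = a ⊗ (r m)` in `A ⊗_ℤ M`. -/
def balancedRel (A M : Type u) [AddCommGroup A] [Module Rᵐᵒᵖ A] [AddCommGroup M] [Module R M] :
    Submodule ℤ (A ⊗[ℤ] M) :=
  Submodule.span ℤ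
    {x | ∃ (a : A) (r : R) (m : M), x = (op r • a) ⊗ₜ[ℤ] m - a ⊗ₜ[ℤ] (r • m)}

/-- The tensor product `A ⊗_R M` of a right `R`-module `A` and a left `R`-module `M`. -/
abbrev BalancedTensor (A M : Type u) [AddCommGroup A] [Module Rᵐᵒᵖ A]
    [AddCommGroup M] [Module R M] : Type u :=
  (A ⊗[ℤ] M) ⧸ balancedRel R A M

variable {A B : Type u} [AddCommGroup A] [Module Rᵐᵒᵖ A] [AddCommGroup B] [Module Rᵐᵒᵖ B]

theorem balancedRel_le_comap (f : A →ₗ[Rᵐᵒᵖ] B) (M : Type u) [AddCommGroup M] [Module R M] :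
    balancedRel R A M ≤
      (balancedRel R B M).comap (LinearMap.rTensor M (f.toAddMonoidHom.toIntLinearMap)) := by
  refine Submodule.span_le.2 ?_
  rintro _ ⟨a, r, m, rfl⟩
  refine Submodule.subset_span ⟨f a, r, m, ?_⟩
  simp

/-- The map `f ⊗ M : A ⊗_R M → B ⊗_R M` induced by a map `f` of right `R`-modules. -/
def balancedTensorMap (f : A →ₗ[Rᵐᵒᵖ] B) (M : Type u) [AddCommGroup M] [Module R M] :
    BalancedTensor R A M →ₗ[ℤ] BalancedTensor R B M :=
  Submodule.mapQ _ _ (LinearMap.rTensor M (f.toAddMonoidHom.toIntLinearMap))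
    (balancedRel_le_comap R f M)

/-- A left `R`-module `M` is flat if `- ⊗_R M` preserves injective maps of right `R`-modules. -/
def IsFlatModule (M : Type u) [AddCommGroup M] [Module R M] : Prop :=
  ∀ (A B : Type u) [AddCommGroup A] [AddCommGroup B] [Module Rᵐᵒᵖ A] [Module Rᵐᵒᵖ B]
    (f : A →ₗ[Rᵐᵒᵖ] B), Function.Injective f → Function.Injective (balancedTensorMap R f M)

/-- `M` has a flat resolution `0 → F_n → ⋯ → F_0 → M → 0` of length at most `n`. -/
def HasFlatDimLE : ℕ → ∀ (M : Type u) [AddCommGroup M] [Module R M], Prop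
  | 0, M, _, _ => IsFlatModule R M
  | n + 1, M, _, _ => ∃ (F : ModuleCat.{u} R) (p : F →ₗ[R] M),
      IsFlatModule R F ∧ Function.Surjective p ∧ HasFlatDimLE n (LinearMap.ker p)

/-- The flat dimension of a left `R`-module: the least length of a flat resolution, and `⊤` if there
is no finite flat resolution. -/
def flatDim (M : Type u) [AddCommGroup M] [Module R M] : ℕ∞ :=
  ⨅ (n : ℕ) (_ : HasFlatDimLE R n M), (n : ℕ∞)

end Flat

/-! ### Injective envelopes -/

/-- `i : M → E` is an injective envelope: `E` is injective, and `i` is an essential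
monomorphism. -/
structure IsInjectiveEnvelope {R : Type u} [Ring R] {M E : Type u} [AddCommGroup M] [Module R M]
    [AddCommGroup E] [Module R E] (i : M →ₗ[R] E) : Prop where
  injective_module : Module.Injective R E
  injective : Function.Injective i
  essential : ∀ N : Submodule R E, N ≠ ⊥ → N ⊓ LinearMap.range i ≠ ⊥

/-- `M` has an injective envelope, and (any choice of) it has flat dimension `n`. -/
def InjectiveEnvelopeHasFlatDim (R : Type u) [Ring R] (M : Type u) [AddCommGroup M] [Module R M]
    (n : ℕ∞) : Prop :=
  (∃ (E : ModuleCat.{u} R) (i : M →ₗ[R] E), IsInjectiveEnvelope i) ∧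
    ∀ (E : ModuleCat.{u} R) (i : M →ₗ[R] E), IsInjectiveEnvelope i → flatDim R E = n

/-! ### The subcategories `E_n(R_R)` -/

section Ext

variable (R : Type u) [Ring R]

/-- Left multiplication by `r`, as an endomorphism of the right module `R_R`. -/
def leftMulHom (r : R) : ModuleCat.of Rᵐᵒᵖ R ⟶ ModuleCat.of Rᵐᵒᵖ R :=
  ModuleCat.ofHom
    { toFun := fun x => r * x
      map_add' := mul_add r
      map_smul' := fun s x => by simp [← mul_assoc] }

/-- The group `Ext^n(N, R_R)` for a right `R`-module `N`. -/
def ExtRegular (N : ModuleCat.{u} Rᵐᵒᵖ) (n : ℕ) : Type u :=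
  Abelian.Ext.{u} N (ModuleCat.of Rᵐᵒᵖ R) n

instance (N : ModuleCat.{u} Rᵐᵒᵖ) (n : ℕ) : AddCommGroup (ExtRegular R N n) :=
  inferInstanceAs (AddCommGroup (Abelian.Ext.{u} N (ModuleCat.of Rᵐᵒᵖ R) n))

/-- The left `R`-module structure of `Ext^n(N, R)`: `r` acts through the endomorphism
`x ↦ r x` of the right module `R_R`. -/
instance (N : ModuleCat.{u} Rᵐᵒᵖ) (n : ℕ) : Module R (ExtRegular R N n) where
  smul r e := Abelian.Ext.comp (c := n) e (Abelian.Ext.mk₀ (leftMulHom R r)) (add_zero n)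
  one_smul e := by
    have h : leftMulHom R 1 = 𝟙 _ := by ext; simp [leftMulHom]
    change Abelian.Ext.comp _ _ _ = e
    rw [h]; exact Abelian.Ext.comp_mk₀_id e
  mul_smul r s e := by
    have h : leftMulHom R (r * s) = leftMulHom R s ≫ leftMulHom R r := by
      ext; simp [leftMulHom]
    change Abelian.Ext.comp _ _ _ = Abelian.Ext.comp (Abelian.Ext.comp _ _ _) _ _
    rw [h, ← Abelian.Ext.mk₀_comp_mk₀]
    exact (Abelian.Ext.comp_assoc_of_third_deg_zero _ _ _ _).symm
  smul_zero r := Abelian.Ext.zero_comp _ _ _ _ _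
  smul_add r e f := Abelian.Ext.add_comp _ _ _ _
  add_smul r s e := by
    have h : leftMulHom R (r + s) = leftMulHom R r + leftMulHom R s := by
      ext; simp [leftMulHom]
    change Abelian.Ext.comp _ _ _ = Abelian.Ext.comp _ _ _ + Abelian.Ext.comp _ _ _
    rw [h, Abelian.Ext.mk₀_add]; exact Abelian.Ext.comp_add _ _ _ _
  zero_smul e := by
    have h : leftMulHom R 0 = 0 := by ext; simp [leftMulHom]
    change Abelian.Ext.comp _ _ _ = 0
    rw [h, Abelian.Ext.mk₀_zero]; exact Abelian.Ext.comp_zero _ _ _ _ _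

/-- `E_n(R_R)`: the finitely generated left `R`-modules that are isomorphic to `Ext^n(N, R_R)` for a
finitely generated right `R`-module `N`. -/
def ExtClass (n : ℕ) : Set (ModuleCat.{u} R) :=
  {M | Module.Finite R M ∧ ∃ N : ModuleCat.{u} Rᵐᵒᵖ,
    Module.Finite Rᵐᵒᵖ N ∧ Nonempty (M ≃ₗ[R] ExtRegular R N n)}

variable {R} in
/-- A class of left modules is submodule-closed if every non-zero submodule of a module in the class
is in the class. -/
def SubmoduleClosed (𝒳 : Set (ModuleCat.{u} R)) : Prop :=
  ∀ M ∈ 𝒳, ∀ L : Submodule R M, L ≠ ⊥ → ModuleCat.of R L ∈ 𝒳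

end Ext

/-! ### Iwanaga-Gorenstein rings -/

/-- `R` is two-sided noetherian and the injective dimensions of the left module `R` and of the right
module `R` are both `n`: an Iwanaga-Gorenstein ring of self-injective dimension `n`. -/
structure IsIwanagaGorensteinOfDim (R : Type u) [Ring R] (n : ℕ) : Prop where
  left_noetherian : IsNoetherianRing R
  right_noetherian : IsNoetherianRing Rᵐᵒᵖ
  left_injectiveDimension : injectiveDimension (ModuleCat.of R R) = n
  right_injectiveDimension : injectiveDimension (ModuleCat.of Rᵐᵒᵖ R) = n

/-- Auslander's question: for every two-sided noetherian ring `R`, is `E_1(R_R)`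
submodule-closed? -/
def AuslanderQuestion : Prop :=
  ∀ (R : Type u) [Ring R], IsNoetherianRing R → IsNoetherianRing Rᵐᵒᵖ →
    SubmoduleClosed (ExtClass R 1)

end

/-! Both failures of submodule closure come from one obstruction. Let e be the idempotent of the
sink 3 (resp. 4) and I the right ideal of elements with zero coefficient at e. Right modules reverse
the arrows, so the simple right module R/I sits at a source and is injective. Suppose that right
modules have projective dimension at most n, where n ≥ 1, and that I kills Extⁿ(N, R). Since Extⁿ(N,
R/I) = 0, the group Extⁿ(N, I) maps onto Extⁿ(N, R); a surjection from a free module R^m to I stays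
surjective on Extⁿ(N, -), because Extⁿ⁺¹ vanishes. The composite R^m → I → R is a row of left
multiplications by elements of I, and these act by zero. Hence Extⁿ(N, R) = 0
(`extRegular_eq_zero`). If some Extⁿ(N, R) with N finitely generated contains y ≠ 0 with e y = y,
then I kills R y because I e = 0, so R y is a non-zero submodule of a member of E_n that is not
itself a member (`not_submoduleClosed_extClass`).

Such y are written down explicitly. A homomorphism on a left ideal, or on an annihilator, defines a
class in Ext¹ or Ext² that vanishes only if the homomorphism is multiplication by an element
(`exists_ext_one`, `exists_ext_two`), and comparing coefficients rules this out. Together with a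
bound n on the global dimension, these classes show that the self-injective dimension is exactly n
on either side. The global dimension is bounded by peeling off one vertex at a time
(`hasProjectiveDimensionLE_of_vertices`), which leaves the kernels of the vertex characters to be
resolved in coordinates.

Global dimension also bounds the flat dimension of an injective envelope from above. For the lower
bound, a relation s x = 0 in a flat module must come from relations s r = 0 in the ring, whereas
injectivity produces an element at vertex 1 that is killed by an arrow without any such reason. For
the square, the same argument is applied once more to the first syzygy, using β α = 0. -/

/-! ### Flat modules and flat dimension. -/

section Flatness

variable {R : Type u} [Ring R]

/-- A relation `s • x = 0` in a flat left module comes from relations `s * r = 0` in the ring. -/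
theorem IsFlatModule.mem_closure_of_smul_eq_zero {F : Type u} [AddCommGroup F] [Module R F]
    (hF : IsFlatModule R F) {s : R} {x : F} (hx : s • x = 0) :
    x ∈ AddSubgroup.closure {z : F | ∃ (r : R) (y : F), s * r = 0 ∧ z = r • y} := by
  let f : R →ₗ[Rᵐᵒᵖ] R :=
    { toFun := fun r => s * r
      map_add' := mul_add s
      map_smul' := fun a r => by simp [← mul_assoc] }
  -- `A` is the right ideal s R, embedded in R by `g`. The element 1 ⊗ x of A ⊗ F goes to s ⊗ x = 1
  -- ⊗ s x = 0, so flatness makes it zero. The action then carries it to the class of x in F / N.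
  let A := R ⧸ LinearMap.ker f
  let g : A →ₗ[Rᵐᵒᵖ] R := (LinearMap.ker f).liftQ f le_rfl
  have hg : Function.Injective g := by
    rw [← LinearMap.ker_eq_bot]
    exact Submodule.ker_liftQ_eq_bot _ _ _ le_rfl
  let N := AddSubgroup.closure {z : F | ∃ (r : R) (y : F), s * r = 0 ∧ z = r • y}
  let one : A := Submodule.Quotient.mk (1 : R)
  have hzero : (Submodule.Quotient.mk (one ⊗ₜ[ℤ] x) : BalancedTensor R A F) = 0 := by
    apply hF A R g hg
    rw [map_zero]
    change (Submodule.Quotient.mk (g one ⊗ₜ[ℤ] x) : BalancedTensor R R F) = 0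
    have h1 : g one = op s • (1 : R) := by
      change s * 1 = _
      simp
    have h2 : g one ⊗ₜ[ℤ] x = (op s • (1 : R)) ⊗ₜ[ℤ] x - (1 : R) ⊗ₜ[ℤ] (s • x) := by
      rw [hx, h1]; simp
    rw [h2, Submodule.Quotient.mk_eq_zero]
    exact Submodule.subset_span ⟨1, s, x, rfl⟩
  let act : A →+ F →+ (F ⧸ N) := QuotientAddGroup.lift _
    { toFun := fun r => (QuotientAddGroup.mk' N).comp (DistribSMul.toAddMonoidHom F r)
      map_zero' := by ext y; simp
      map_add' := fun a b => by ext y; simp [add_smul] } (by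
      intro r hr
      ext y
      change (QuotientAddGroup.mk' N) (r • y) = 0
      rw [QuotientAddGroup.mk'_apply, QuotientAddGroup.eq_zero_iff]
      exact AddSubgroup.subset_closure ⟨r, y, hr, rfl⟩)
  let Φ : A ⊗[ℤ] F →+ (F ⧸ N) := TensorProduct.liftAddHom act (fun n a y => by simp)
  have hΦ : balancedRel R A F ≤ LinearMap.ker Φ.toIntLinearMap := by
    refine Submodule.span_le.2 ?_
    rintro _ ⟨a, r, m, rfl⟩
    obtain ⟨a, rfl⟩ := Submodule.Quotient.mk_surjective _ a
    rw [SetLike.mem_coe, LinearMap.mem_ker, map_sub, sub_eq_zero]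
    change (QuotientAddGroup.mk' N) ((a * r) • m) = (QuotientAddGroup.mk' N) (a • r • m)
    rw [mul_smul]
  rw [Submodule.Quotient.mk_eq_zero] at hzero
  have h3 : (QuotientAddGroup.mk' N) ((1 : R) • x) = 0 := hΦ hzero
  rwa [one_smul, QuotientAddGroup.mk'_apply, QuotientAddGroup.eq_zero_iff] at h3

/-- Projective modules are flat. -/
theorem isFlatModule_of_projective (P : Type u) [AddCommGroup P] [Module R P]
    [Module.Projective R P] : IsFlatModule R P := by
  obtain ⟨s, hs⟩ := Module.projective_def'.1 (inferInstance : Module.Projective R P)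
  intro A B _ _ _ _ f hf
  -- The splitting `s` makes P a summand of a free module, so C ⊗ P is a retract of a direct power
  -- of C. The embedding `Φ` is natural in C, and injectivity of f can be tested coordinatewise.
  have key : ∀ (C : Type u) [AddCommGroup C] [Module Rᵐᵒᵖ C], ∃ Φ : BalancedTensor R C P →+ (P →₀ C),
      ∃ Ψ : (P →₀ C) →+ BalancedTensor R C P, (∀ z, Ψ (Φ z) = z) ∧
        ∀ c p q, Φ (Submodule.Quotient.mk (c ⊗ₜ[ℤ] p)) q = op (s p q) • c := by
    intro C _ _
    let act : C →+ P →+ (P →₀ C) :=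
      { toFun := fun c =>
          { toFun := fun p => (s p).mapRange (fun r => op r • c) (by simp)
            map_zero' := by ext; simp
            map_add' := fun a b => by ext; simp [add_smul] }
        map_zero' := by ext; simp
        map_add' := fun a b => by ext; simp }
    let Φ₀ : C ⊗[ℤ] P →+ (P →₀ C) := TensorProduct.liftAddHom act (fun n a y => by simp)
    have hΦ : balancedRel R C P ≤ LinearMap.ker Φ₀.toIntLinearMap := by
      refine Submodule.span_le.2 ?_
      rintro _ ⟨a, r, m, rfl⟩
      rw [SetLike.mem_coe, LinearMap.mem_ker, map_sub, sub_eq_zero]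
      ext q
      change op (s m q) • op r • a = op (s (r • m) q) • a
      simp [smul_smul]
    let Φ : BalancedTensor R C P →+ (P →₀ C) :=
      ((balancedRel R C P).liftQ Φ₀.toIntLinearMap hΦ).toAddMonoidHom
    let Ψ : (P →₀ C) →+ BalancedTensor R C P := Finsupp.liftAddHom fun p =>
      { toFun := fun c => Submodule.Quotient.mk (c ⊗ₜ[ℤ] p)
        map_zero' := by simp
        map_add' := fun a b => by simp [TensorProduct.add_tmul] }
    refine ⟨Φ, Ψ, ?_, fun c p q => rfl⟩
    intro z
    obtain ⟨z, rfl⟩ := Submodule.Quotient.mk_surjective _ z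
    induction z using TensorProduct.induction_on with
    | zero => simp
    | add x y hx hy => rw [Submodule.Quotient.mk_add, map_add, map_add, hx, hy]
    | tmul c p =>
      have h1 : Φ (Submodule.Quotient.mk (c ⊗ₜ[ℤ] p)) =
        (s p).mapRange (fun r => op r • c) (by simp) := rfl
      have h2 : ∀ (q : P) (r : R), (Submodule.Quotient.mk ((op r • c) ⊗ₜ[ℤ] q) :
          BalancedTensor R C P) = Submodule.Quotient.mk (c ⊗ₜ[ℤ] (r • q)) := by
        intro q r
        rw [Submodule.Quotient.eq]
        exact Submodule.subset_span ⟨c, r, q, rfl⟩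
      rw [h1]
      change (Finsupp.mapRange _ _ _).sum _ = _
      rw [Finsupp.sum_mapRange_index (by simp)]
      change (s p).sum (fun q r => (Submodule.Quotient.mk ((op r • c) ⊗ₜ[ℤ] q) :
          BalancedTensor R C P)) = _
      simp only [h2]
      have h3 : p = (s p).sum (fun q r => r • q) := by
        have := LinearMap.congr_fun hs p
        simpa [Finsupp.linearCombination_apply] using this.symm
      conv_rhs => rw [h3]
      simp only [Finsupp.sum, TensorProduct.tmul_sum, ← Submodule.mkQ_apply, map_sum]
  obtain ⟨ΦA, ΨA, hA, hA'⟩ := key A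
  obtain ⟨ΦB, ΨB, hB, hB'⟩ := key B
  have comm : ∀ z q, ΦB (balancedTensorMap R f P z) q = f (ΦA z q) := by
    intro z q
    obtain ⟨z, rfl⟩ := Submodule.Quotient.mk_surjective _ z
    induction z using TensorProduct.induction_on with
    | zero => simp
    | add x y hx hy =>
      rw [Submodule.Quotient.mk_add, map_add, map_add, map_add, Finsupp.add_apply, hx, hy,
        Finsupp.add_apply, map_add]
    | tmul c p =>
      rw [hA', map_smul]
      exact hB' (f c) p q
  intro z w hzw
  have : ΦA z = ΦA w := by
    ext q
    exact hf (by rw [← comm, ← comm, hzw])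
  rw [← hA z, ← hA w, this]

/-- A module of projective dimension at most `n` has flat dimension at most `n`. -/
theorem hasFlatDimLE_of_hasProjectiveDimensionLE (n : ℕ) (M : Type u) [AddCommGroup M] [Module R M]
    (h : HasProjectiveDimensionLE (ModuleCat.of R M) n) : HasFlatDimLE R n M := by
  induction n generalizing M with
  | zero =>
    have : Module.Projective R M := (IsProjective.iff_projective M).2
      ((projective_iff_hasProjectiveDimensionLE_zero _).2 h)
    exact isFlatModule_of_projective M
  | succ n ih =>
    have hp : Function.Surjective (Finsupp.linearCombination R (id : M → M)) :=
      Finsupp.linearCombination_id_surjective R M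
    have ex := LinearMap.shortExact_shortComplexKer hp
    refine ⟨ModuleCat.of R (M →₀ R), Finsupp.linearCombination R id,
      isFlatModule_of_projective _, hp, ih _ ?_⟩
    have : Projective (ModuleCat.of R (M →₀ R)) := ModuleCat.projective_of_categoryTheory_projective _
    exact (ex.hasProjectiveDimensionLT_X₃_iff n this).1 h

theorem flatDim_eq_of_not {M : Type u} [AddCommGroup M] [Module R M] {n : ℕ}
    (h : HasFlatDimLE R n M) (h' : ∀ m < n, ¬ HasFlatDimLE R m M) : flatDim R M = n := by
  refine le_antisymm (iInf₂_le n h) (le_iInf₂ fun m hm => ?_)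
  by_contra hlt
  exact h' m (by simpa using hlt) hm

end Flatness

/-! ### Existence of injective envelopes. -/

section InjectiveEnvelope

variable {R : Type u} [Ring R]

theorem module_injective_of_isCompl {Q : Type u} [AddCommGroup Q] [Module R Q]
    (hQ : Module.Injective R Q) {E F : Submodule R Q} (h : IsCompl E F) : Module.Injective R E where
  out X Y _ _ _ _ f hf g := by
    obtain ⟨k, hk⟩ := hQ.out f hf (E.subtype ∘ₗ g)
    refine ⟨E.projectionOnto F h ∘ₗ k, fun x => ?_⟩
    simp [hk]

/-- Injective envelopes exist. -/
theorem exists_isInjectiveEnvelope (M : Type u) [AddCommGroup M] [Module R M] :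
    ∃ (E : ModuleCat.{u} R) (i : M →ₗ[R] E), IsInjectiveEnvelope i := by
  let pres := (EnoughInjectives.presentation (ModuleCat.of R M)).some
  let Q := pres.J
  have hQ' := pres.injective
  have hQ : Module.Injective R Q := Module.injective_module_of_injective_object R Q
  let j : M →ₗ[R] Q := pres.f.hom
  have hj : Function.Injective j := (ModuleCat.mono_iff_injective pres.f).1 pres.mono
  -- Essentiality in elementwise form, which passes to unions of chains. `E` will be a maximal
  -- essential extension of the image of M inside the injective module Q.
  let Ess : Submodule R Q → Submodule R Q → Prop := fun A B =>
    ∀ x ∈ B, x ≠ 0 → ∃ r : R, r • x ≠ 0 ∧ r • x ∈ A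
  let S : Set (Submodule R Q) := {N | Ess (LinearMap.range j) N}
  obtain ⟨E, hE, hmax⟩ := zorn_le_nonempty₀ S (by
    intro c hc hchain y hy
    refine ⟨sSup c, ?_, fun z hz => le_sSup hz⟩
    intro x hx hx0
    obtain ⟨N, hN, hxN⟩ := (Submodule.mem_sSup_of_directed ⟨y, hy⟩ hchain.directedOn).1 hx
    exact hc hN x hxN hx0) (LinearMap.range j) (fun x hx hx0 => ⟨1, by simpa using hx0, by simpa using hx⟩)
  -- A maximal `F` disjoint from `E` makes the image of E essential in Q / F. The aim is Q = E ⊕ F,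
  -- so that E inherits injectivity.
  obtain ⟨F, hF, hFmax⟩ := zorn_le_nonempty₀ {N : Submodule R Q | Disjoint E N} (by
    intro c hc hchain y hy
    refine ⟨sSup c, ?_, fun z hz => le_sSup hz⟩
    rw [Set.mem_ofPred_eq, Submodule.disjoint_def]
    intro x hxE hx
    obtain ⟨N, hN, hxN⟩ := (Submodule.mem_sSup_of_directed ⟨y, hy⟩ hchain.directedOn).1 hx
    exact Submodule.disjoint_def.1 (hc hN) x hxE hxN) ⊥ disjoint_bot_right
  have hEF : Disjoint E F := hFmax.prop
  let p : E →ₗ[R] (Q ⧸ F) := F.mkQ ∘ₗ E.subtype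
  have hp : Function.Injective p := by
    rw [← LinearMap.ker_eq_bot, LinearMap.ker_eq_bot']
    intro x hx
    have : (x : Q) ∈ F := by simpa [p] using hx
    exact Subtype.ext (Submodule.disjoint_def.1 hEF x x.2 this)
  obtain ⟨g, hg⟩ := hQ.out p hp E.subtype
  have hgE : ∀ x ∈ E, g (F.mkQ x) = x := fun x hx => hg ⟨x, hx⟩
  have hess : ∀ x : Q ⧸ F, x ≠ 0 → ∃ (r : R) (e : Q), e ∈ E ∧ e ≠ 0 ∧ r • x = F.mkQ e := by
    intro x hx
    obtain ⟨x, rfl⟩ := F.mkQ_surjective x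
    by_contra! hcon
    have hd : Disjoint E (F ⊔ Submodule.span R {x}) := by
      rw [Submodule.disjoint_def]
      intro e he hef
      obtain ⟨f, hf, y, hy, rfl⟩ := Submodule.mem_sup.1 hef
      obtain ⟨r, rfl⟩ := Submodule.mem_span_singleton.1 hy
      by_contra hne
      refine hcon r _ he hne ?_
      have hf0 : F.mkQ f = 0 := (Submodule.Quotient.mk_eq_zero F).2 hf
      rw [map_add, map_smul, hf0, zero_add]
    have hle := hFmax.le_of_ge hd le_sup_left
    exact hx ((Submodule.Quotient.mk_eq_zero F).2
      (hle (Submodule.mem_sup_right (Submodule.mem_span_singleton_self x))))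
  -- The map `g` undoes E → Q / F, so essentiality forces it to be injective. Its range is again
  -- essential over the image of M, and maximality of E gives `range g = E`; thus g splits off F.
  have hginj : ∀ x, g x = 0 → x = 0 := by
    intro x hx
    by_contra hx0
    obtain ⟨r, e, he, he0, hr⟩ := hess x hx0
    apply he0
    rw [← hgE e he, ← hr, map_smul, hx, smul_zero]
  have hEG : E ≤ LinearMap.range g := fun x hx => ⟨_, hgE x hx⟩
  have hG : LinearMap.range g ≤ E := by
    refine hmax.le_of_ge ?_ hEG
    rintro _ ⟨x, rfl⟩ hx0
    obtain ⟨r, e, he, he0, hr⟩ := hess x (fun h => hx0 (by rw [h, map_zero]))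
    obtain ⟨t, ht0, ht⟩ := hmax.prop e he he0
    have h1 : (t * r) • g x = t • e := by
      rw [mul_smul, ← map_smul, hr, hgE e he]
    exact ⟨t * r, by rwa [h1], by rwa [h1]⟩
  have hcompl : IsCompl E F := by
    refine ⟨hEF, codisjoint_iff_le_sup.2 fun x _ => ?_⟩
    have he : g (F.mkQ x) ∈ E := hG ⟨_, rfl⟩
    have h1 : F.mkQ x - F.mkQ (g (F.mkQ x)) = 0 := hginj _ (by rw [map_sub, hgE _ he, sub_self])
    rw [← map_sub] at h1
    have h2 := (Submodule.Quotient.mk_eq_zero F).1 h1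
    exact Submodule.mem_sup.2 ⟨_, he, _, h2, by abel⟩
  refine ⟨ModuleCat.of R E, j.codRestrict E fun x => hE ⟨x, rfl⟩,
    module_injective_of_isCompl hQ hcompl, fun x y hxy => hj (congrArg Subtype.val hxy), ?_⟩
  intro N hN hbot
  obtain ⟨x, hx, hx0⟩ := Submodule.exists_mem_ne_zero_of_ne_bot hN
  obtain ⟨r, hr0, y, hy⟩ := hmax.prop x x.2 (fun h => hx0 (Subtype.ext h))
  have hmem : r • x ∈ N ⊓ LinearMap.range (j.codRestrict E fun x => hE ⟨x, rfl⟩) :=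
    ⟨N.smul_mem r hx, y, Subtype.ext hy⟩
  rw [hbot, Submodule.mem_bot] at hmem
  exact hr0 (congrArg Subtype.val hmem)

end InjectiveEnvelope

/-! ### Projective dimension and injectivity through vertex characters. -/

section ProjectiveDimension

variable {T : Type u} [Ring T]

theorem shortExact_of_exact {L M N : Type u} [AddCommGroup L] [AddCommGroup M] [AddCommGroup N]
    [Module T L] [Module T M] [Module T N] {f : L →ₗ[T] M} {g : M →ₗ[T] N}
    (hfg : Function.Exact f g) (hf : Function.Injective f) (hg : Function.Surjective g) :
    (ModuleCat.shortComplexOfCompEqZero f g hfg.linearMap_comp_eq_zero).ShortExact :=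
  ModuleCat.shortComplex_shortExact _ hfg hf hg

theorem shortExact_submodule {M : Type u} [AddCommGroup M] [Module T M] (N : Submodule T M) :
    (ModuleCat.shortComplexOfCompEqZero N.subtype N.mkQ
      (LinearMap.exact_subtype_mkQ N).linearMap_comp_eq_zero).ShortExact :=
  shortExact_of_exact (LinearMap.exact_subtype_mkQ N) N.injective_subtype N.mkQ_surjective

theorem hasProjectiveDimensionLE_of_submodule {M : Type u} [AddCommGroup M] [Module T M]
    (N : Submodule T M) (n : ℕ) (hN : HasProjectiveDimensionLE (ModuleCat.of T N) n)
    (hQ : HasProjectiveDimensionLE (ModuleCat.of T (M ⧸ N)) n) :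
    HasProjectiveDimensionLE (ModuleCat.of T M) n :=
  (shortExact_submodule N).hasProjectiveDimensionLT_X₂ (n + 1) hN hQ

/-- The projective dimension does not grow under taking direct powers. -/
theorem hasProjectiveDimensionLE_finsupp (ι : Type u) (n : ℕ) (X : Type u) [AddCommGroup X]
    [Module T X] (h : HasProjectiveDimensionLE (ModuleCat.of T X) n) :
    HasProjectiveDimensionLE (ModuleCat.of T (ι →₀ X)) n := by
  classical
  induction n generalizing X with
  | zero =>
    have : Module.Projective T X := (IsProjective.iff_projective X).2
      ((projective_iff_hasProjectiveDimensionLE_zero _).2 h)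
    exact (projective_iff_hasProjectiveDimensionLE_zero _).1
      ((IsProjective.iff_projective _).1 (Module.Projective.of_equiv (finsuppLequivDFinsupp (ι := ι) (M := X) T).symm))
  | succ n ih =>
    -- Dimension shift along a free cover; direct powers keep the sequence exact and its middle term
    -- projective.
    obtain ⟨F, _, _, _, p, hp⟩ : ∃ (F : Type u) (_ : AddCommGroup F) (_ : Module T F)
        (_ : Module.Projective T F) (p : F →ₗ[T] X), Function.Surjective p :=
      ⟨X →₀ T, inferInstance, inferInstance, inferInstance, Finsupp.linearCombination T id,
        Finsupp.linearCombination_id_surjective T X⟩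
    have hker := ih _ (((LinearMap.shortExact_shortComplexKer hp).hasProjectiveDimensionLT_X₃_iff n
      ((IsProjective.iff_projective F).1 inferInstance)).1 h)
    let f : (ι →₀ LinearMap.ker p) →ₗ[T] (ι →₀ F) :=
      Finsupp.mapRange.linearMap (Submodule.subtype _)
    let g : (ι →₀ F) →ₗ[T] (ι →₀ X) := Finsupp.mapRange.linearMap p
    have hfg : Function.Exact f g := by
      rw [LinearMap.exact_iff]
      change LinearMap.ker (Finsupp.mapRange.linearMap _) =
        LinearMap.range (Finsupp.mapRange.linearMap _)
      rw [Finsupp.ker_mapRange, Finsupp.range_mapRange_linearMap _ (Submodule.ker_subtype _),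
        Submodule.range_subtype]
    have hS := shortExact_of_exact (f := f) (g := g) hfg
      (Finsupp.mapRange_injective _ rfl (Submodule.injective_subtype _))
      (Finsupp.mapRange_surjective _ (map_zero _) hp)
    exact (hS.hasProjectiveDimensionLT_X₃_iff n ((IsProjective.iff_projective _).1
      (Module.Projective.of_equiv (finsuppLequivDFinsupp (ι := ι) (M := F) T).symm))).2 hker

variable {K : Type u} [Field K] [Algebra K T]

/-- A module on which the ring acts through a character `χ` with values in a field is a direct power
of the simple module `T / ker χ`. -/
theorem hasProjectiveDimensionLE_of_character (χ : T →ₐ[K] K) (n : ℕ)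
    (hχ : HasProjectiveDimensionLE (ModuleCat.of T (RingHom.ker χ)) n)
    (Q : Type u) [AddCommGroup Q] [Module T Q]
    (hQ : ∀ (t : T) (q : Q), t • q = algebraMap K T (χ t) • q) :
    HasProjectiveDimensionLE (ModuleCat.of T Q) (n + 1) := by
  -- A K-basis of Q presents it as the direct power of T modulo the same power of ker χ.
  let _ : Module K Q := Module.compHom Q (algebraMap K T)
  have hK : ∀ (c : K) (q : Q), c • q = algebraMap K T c • q := fun _ _ => rfl
  let b := Module.Basis.ofVectorSpace K Q
  let ι := Module.Basis.ofVectorSpaceIndex K Q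
  let f : (ι →₀ RingHom.ker χ) →ₗ[T] (ι →₀ T) := Finsupp.mapRange.linearMap (Submodule.subtype _)
  let g : (ι →₀ T) →ₗ[T] Q := Finsupp.linearCombination T b
  have hg : ∀ x, g x = Finsupp.linearCombination K b (x.mapRange χ (map_zero χ)) := by
    intro x
    change Finsupp.linearCombination T b x = _
    rw [Finsupp.linearCombination_apply, Finsupp.linearCombination_apply,
      Finsupp.sum_mapRange_index (by simp)]
    exact Finsupp.sum_congr fun i _ => by rw [hQ, hK]
  have hfg : Function.Exact f g := by
    intro x
    rw [hg]
    constructor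
    · intro hx
      have h0 := (linearIndependent_iff.1 b.linearIndependent) _ hx
      have h1 : ∀ i, x i ∈ RingHom.ker χ := fun i => by
        rw [RingHom.mem_ker]; exact DFunLike.congr_fun h0 i
      have hmem : x ∈ LinearMap.range f := by
        change x ∈ LinearMap.range (Finsupp.mapRange.linearMap _)
        rw [Finsupp.range_mapRange_linearMap _ (Submodule.ker_subtype _), Submodule.range_subtype]
        exact fun i => h1 i
      exact hmem
    · rintro ⟨y, rfl⟩
      have : (f y).mapRange χ (map_zero χ) = 0 := by
        ext i
        exact (y i).2
      rw [this, map_zero]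
  have hsurj : Function.Surjective g := by
    intro q
    obtain ⟨x, hx⟩ : ∃ x, Finsupp.linearCombination K b x = q := by
      rw [← LinearMap.mem_range, Finsupp.range_linearCombination, b.span_eq]; trivial
    refine ⟨x.mapRange (algebraMap K T) (map_zero _), ?_⟩
    rw [hg, ← hx]
    congr 1
    ext i
    simp
  have hS := shortExact_of_exact (f := f) (g := g) hfg
    (Finsupp.mapRange_injective _ rfl (Submodule.injective_subtype _)) hsurj
  have proj : Projective (ModuleCat.of T (ι →₀ T)) :=
    ModuleCat.projective_of_categoryTheory_projective _
  exact (hS.hasProjectiveDimensionLT_X₃_iff n proj).2 (hasProjectiveDimensionLE_finsupp ι n _ hχ)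

/-- If `e` cuts out the part of `M` at a source vertex with character `χ`, then the projective
dimension of `M` is bounded by those of `ker χ` and of the submodules killed by `e`. -/
theorem hasProjectiveDimensionLE_of_source (χ : T →ₐ[K] K) (e : T) (n : ℕ)
    (hχ : HasProjectiveDimensionLE (ModuleCat.of T (RingHom.ker χ)) n)
    (M : Type u) [AddCommGroup M] [Module T M]
    (hM : ∀ (t : T) (m : M), e • t • m = algebraMap K T (χ t) • e • m)
    (hN : ∀ N : Submodule T M, (∀ x ∈ N, e • x = 0) →
      HasProjectiveDimensionLE (ModuleCat.of T N) (n + 1)) :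
    HasProjectiveDimensionLE (ModuleCat.of T M) (n + 1) := by
  -- The elements killed by e form a submodule by `hM`, and T acts on the quotient through χ, since
  -- e kills t m - χ(t) m.
  let N : Submodule T M :=
    { carrier := {x | e • x = 0}
      add_mem' := fun {a b} ha hb => by
        rw [Set.mem_ofPred_eq] at *; rw [smul_add, ha, hb, add_zero]
      zero_mem' := smul_zero e
      smul_mem' := fun t x hx => by
        rw [Set.mem_ofPred_eq] at *; rw [hM, hx, smul_zero] }
  refine hasProjectiveDimensionLE_of_submodule N (n + 1) (hN N fun x hx => hx)
    (hasProjectiveDimensionLE_of_character χ n hχ _ ?_)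
  intro t q
  obtain ⟨m, rfl⟩ := N.mkQ_surjective q
  rw [← map_smul, ← map_smul, ← sub_eq_zero, ← map_sub]
  refine (Submodule.Quotient.mk_eq_zero N).2 ?_
  change e • (t • m - algebraMap K T (χ t) • m) = 0
  rw [smul_sub, hM, hM, χ.commutes, sub_eq_zero]
  simp

/-- A module on which `T` acts through the character of a source vertex is injective. -/
theorem module_injective_of_character (χ : T →ₐ[K] K) (e : T) (he : χ e = 1)
    (het : ∀ t, e * t = algebraMap K T (χ t) * e) (X : Type u) [AddCommGroup X] [Module T X]
    (hX : ∀ (t : T) (x : X), t • x = algebraMap K T (χ t) • x) : Module.Injective T X := by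
  refine Module.Baer.injective fun J g => ?_
  have heX : ∀ x : X, e • x = x := fun x => by rw [hX, he]; simp
  have hg : ∀ x (hx : x ∈ J), g ⟨x, hx⟩ = g ⟨e * x, J.mul_mem_left e hx⟩ := fun x hx => by
    have := g.map_smul e ⟨x, hx⟩
    rw [heX] at this
    exact this.symm
  -- Baer's criterion: g only sees e x = χ(x) e. If χ vanishes on J, then g = 0; otherwise e itself
  -- lies in J and g is the action on g(e).
  by_cases hJ : ∀ x ∈ J, χ x = 0
  · refine ⟨0, fun x hx => ?_⟩
    have h0 : e * x = 0 := by rw [het, hJ x hx]; simp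
    rw [hg]
    simp only [h0, LinearMap.zero_apply]
    exact (map_zero g).symm
  · push Not at hJ
    obtain ⟨x₀, hx₀, hne⟩ := hJ
    have heJ : e ∈ J := by
      have h1 : algebraMap K T (χ x₀)⁻¹ * (e * x₀) ∈ J := J.mul_mem_left _ (J.mul_mem_left _ hx₀)
      rw [het, ← mul_assoc, ← map_mul, inv_mul_cancel₀ hne] at h1
      simpa using h1
    refine ⟨LinearMap.toSpanSingleton T X (g ⟨e, heJ⟩), fun x hx => ?_⟩
    rw [LinearMap.toSpanSingleton_apply, hX, ← map_smul, hg x hx]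
    congr 1
    exact Subtype.ext (het x).symm

end ProjectiveDimension

/-! ### Explicit Ext classes and the obstruction to submodule closure. -/

section ExtClasses

/-- In the long exact sequence the kernel of the connecting map is the image of Ext from the
projective middle term, which vanishes in positive degree. -/
theorem ext_eq_zero_of_extClass_comp_eq_zero {T : Type u} [Ring T]
    {S : ShortComplex (ModuleCat.{u} T)} (hS : S.ShortExact) [Projective S.X₂] {Y : ModuleCat.{u} T}
    {n : ℕ} (x : Abelian.Ext S.X₁ Y (n + 1)) {m : ℕ} (hm : 1 + (n + 1) = m)
    (h : hS.extClass.comp x hm = 0) : x = 0 := by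
  obtain ⟨z, rfl⟩ := Abelian.Ext.contravariant_sequence_exact₁ hS Y x hm h
  rw [Abelian.Ext.eq_zero_of_projective z, Abelian.Ext.comp_zero]

/-- By the long exact sequence the map extends to T, and a map out of T is the action on the image
of 1. -/
theorem exists_eq_smul_of_extClass_comp_eq_zero {T : Type u} [Ring T] {A : Submodule T T}
    {C : Type u} [AddCommGroup C] [Module T C] {p : T →ₗ[T] C} (hp : p ∘ₗ A.subtype = 0)
    (hS : (ModuleCat.shortComplexOfCompEqZero A.subtype p hp).ShortExact) {Y : ModuleCat.{u} T}
    (h : ModuleCat.of T A ⟶ Y) (h0 : hS.extClass.comp (Abelian.Ext.mk₀ h) (add_zero 1) = 0) :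
    ∃ y : Y, ∀ t : A, h t = (t : T) • y := by
  obtain ⟨k, hk⟩ := Abelian.Ext.contravariant_sequence_exact₁ hS Y _ (add_zero 1) h0
  obtain ⟨k, rfl⟩ := (Abelian.Ext.mk₀_bijective _ _).2 k
  rw [Abelian.Ext.mk₀_comp_mk₀, (Abelian.Ext.mk₀_bijective _ _).1.eq_iff] at hk
  let k' : T →ₗ[T] Y := k.hom
  refine ⟨k' 1, fun t => ?_⟩
  rw [← map_smul, smul_eq_mul, mul_one, ← hk]
  rfl

/-- A map from a left ideal `I` to `Y` with trivial class in `Ext¹(T / I, Y)` is given by the action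
on an element of `Y`. -/
theorem exists_ext_one {T : Type u} [Ring T] (I : Submodule T T) :
    ∃ ξ : Abelian.Ext (ModuleCat.of T (T ⧸ I)) (ModuleCat.of T I) 1,
      ∀ (Y : ModuleCat.{u} T) (h : ModuleCat.of T I ⟶ Y),
        ξ.comp (Abelian.Ext.mk₀ h) (add_zero 1) = 0 → ∃ y : Y, ∀ t : I, h t = (t : T) • y :=
  ⟨(shortExact_submodule I).extClass, fun _ h h0 =>
    exists_eq_smul_of_extClass_comp_eq_zero _ (shortExact_submodule I) h h0⟩

/-- A map from the left annihilator of `b` to `Y` with trivial class in `Ext²(T / T b, Y)` is given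
by the action on an element of `Y`. -/
theorem exists_ext_two {T : Type u} [Ring T] (b : T) :
    ∃ ξ : Abelian.Ext
        (ModuleCat.of T (T ⧸ LinearMap.range (LinearMap.toSpanSingleton T T b)))
        (ModuleCat.of T (LinearMap.ker (LinearMap.toSpanSingleton T T b))) 2,
      ∀ (Y : ModuleCat.{u} T)
        (h : ModuleCat.of T (LinearMap.ker (LinearMap.toSpanSingleton T T b)) ⟶ Y),
        ξ.comp (Abelian.Ext.mk₀ h) (add_zero 2) = 0 →
          ∃ y : Y, ∀ t : LinearMap.ker (LinearMap.toSpanSingleton T T b), h t = (t : T) • y := by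
  let f := LinearMap.toSpanSingleton T T b
  have hfg : Function.Exact (LinearMap.ker f).subtype f.rangeRestrict := by
    rw [LinearMap.exact_iff, LinearMap.ker_rangeRestrict, Submodule.range_subtype]
  have hS₁ := shortExact_of_exact hfg (Submodule.injective_subtype _)
      (LinearMap.surjective_rangeRestrict _)
  have hS₂ := shortExact_submodule (LinearMap.range f)
  have proj : Projective (ModuleCat.of T T) := ModuleCat.projective_of_categoryTheory_projective _
  -- The Yoneda splice of 0 → ker → T → T b → 0 with 0 → T b → T → T / T b → 0. Composing with the
  -- class of the second sequence is injective in positive degree, so the question drops to Ext¹.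
  refine ⟨hS₂.extClass.comp hS₁.extClass (by norm_num), fun Y h h0 => ?_⟩
  rw [Abelian.Ext.comp_assoc_of_third_deg_zero] at h0
  have h1 := ext_eq_zero_of_extClass_comp_eq_zero hS₂ (n := 0) _ _ h0
  exact exists_eq_smul_of_extClass_comp_eq_zero _ hS₁ h h1

/-- `Ext` of finitely generated right modules with values in the regular module is finitely
generated over a noetherian ring. -/
theorem finite_extRegular (R : Type u) [Ring R] [IsNoetherianRing R] [IsNoetherianRing Rᵐᵒᵖ]
    (N : ModuleCat.{u} Rᵐᵒᵖ) [Module.Finite Rᵐᵒᵖ N] (n : ℕ) :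
    Module.Finite R (ExtRegular R N n) := by
  induction n generalizing N with
  | zero =>
    obtain ⟨s, hs⟩ := (inferInstance : Module.Finite Rᵐᵒᵖ N)
    -- Evaluation at finitely many generators embeds Hom(N, R) in a finite power of R, which is
    -- noetherian.
    let ev : ExtRegular R N 0 →ₗ[R] (s → R) :=
      { toFun := fun x i => (Abelian.Ext.addEquiv₀ (X := N) (Y := ModuleCat.of Rᵐᵒᵖ R) x).hom (i : N)
        map_add' := fun x y => by
          ext i
          have h := map_add (Abelian.Ext.addEquiv₀ (X := N) (Y := ModuleCat.of Rᵐᵒᵖ R)) x y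
          exact congrArg (fun f => f.hom (i : N)) h
        map_smul' := fun r x => by
          obtain ⟨x, rfl⟩ := (Abelian.Ext.addEquiv₀ (X := N) (Y := ModuleCat.of Rᵐᵒᵖ R)).symm.surjective x
          ext i
          change (Abelian.Ext.addEquiv₀ (Abelian.Ext.comp (Abelian.Ext.mk₀ x)
            (Abelian.Ext.mk₀ (leftMulHom R r)) (add_zero 0))).hom (i : N) = _
          rw [Abelian.Ext.mk₀_comp_mk₀, AddEquiv.apply_symm_apply]
          erw [AddEquiv.apply_symm_apply]
          rfl }
    refine Module.Finite.of_injective ev ?_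
    intro x y hxy
    apply (Abelian.Ext.addEquiv₀ (X := N) (Y := ModuleCat.of Rᵐᵒᵖ R)).injective
    ext1
    refine LinearMap.ext_on hs fun i hi => ?_
    exact congrFun hxy ⟨i, hi⟩
  | succ n ih =>
    obtain ⟨m, f, hf⟩ := Module.Finite.exists_fin' Rᵐᵒᵖ N
    have hS := LinearMap.shortExact_shortComplexKer hf
    have proj : Projective (ModuleCat.of Rᵐᵒᵖ (Fin m → Rᵐᵒᵖ)) :=
      ModuleCat.projective_of_categoryTheory_projective _
    have hfin := ih (ModuleCat.of Rᵐᵒᵖ (LinearMap.ker f))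
    -- The connecting map of a finite free cover is onto, since Ext of the cover vanishes in degree
    -- n + 1; the kernel is finitely generated by right noetherianity.
    let δ : ExtRegular R (ModuleCat.of Rᵐᵒᵖ (LinearMap.ker f)) n →ₗ[R] ExtRegular R N (n + 1) :=
      { toFun := fun x => hS.extClass.comp x (add_comm 1 n)
        map_add' := fun x y => Abelian.Ext.comp_add _ _ _ _
        map_smul' := fun r x => (Abelian.Ext.comp_assoc_of_third_deg_zero _ _ _ _).symm }
    exact Module.Finite.of_surjective δ fun x =>
      Abelian.Ext.contravariant_sequence_exact₃ hS _ x (Abelian.Ext.eq_zero_of_projective _)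
        (add_comm 1 n)

/-- If `Extⁿ(N, -)` is right exact and vanishes on `R / I`, and `I` acts by zero on `Extⁿ(N, R)`,
then `Extⁿ(N, R) = 0`. -/
theorem extRegular_eq_zero {R : Type u} [Ring R] [IsNoetherianRing Rᵐᵒᵖ] (I : Submodule Rᵐᵒᵖ R)
    (N : ModuleCat.{u} Rᵐᵒᵖ) (n : ℕ) (hN : HasProjectiveDimensionLE N n)
    (hI : ∀ x : Abelian.Ext N (ModuleCat.of Rᵐᵒᵖ (R ⧸ I)) n, x = 0)
    (hkill : ∀ s ∈ I, ∀ z : ExtRegular R N n, s • z = 0) (y : ExtRegular R N n) : y = 0 := by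
  have hfin : IsNoetherian Rᵐᵒᵖ R := isNoetherian_of_linearEquiv
    (MulOpposite.opLinearEquiv Rᵐᵒᵖ (M := R)).symm
  obtain ⟨m, g, hg⟩ := Module.Finite.exists_fin' Rᵐᵒᵖ I
  -- Lift `y` to Extⁿ(N, I), then to Extⁿ(N, -) of a finite free cover of I; the second lift is
  -- unobstructed because Extⁿ⁺¹(N, -) = 0.
  obtain ⟨w, rfl⟩ := Abelian.Ext.covariant_sequence_exact₂ N (shortExact_submodule I) y (hI _)
  have hS := LinearMap.shortExact_shortComplexKer hg
  obtain ⟨v, rfl⟩ := Abelian.Ext.covariant_sequence_exact₃ N hS w rfl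
    (Abelian.Ext.eq_zero_of_hasProjectiveDimensionLT _ (n + 1) le_rfl)
  let F := ModuleCat.of Rᵐᵒᵖ (Fin m → Rᵐᵒᵖ)
  let a : Fin m → R := fun i => (g (Pi.single i 1) : R)
  let pr : Fin m → (F ⟶ ModuleCat.of Rᵐᵒᵖ R) := fun i => ModuleCat.ofHom
    ((MulOpposite.opLinearEquiv Rᵐᵒᵖ (M := R)).symm.toLinearMap ∘ₗ LinearMap.proj i)
  -- The composite from the free module to R is a sum of coordinate projections followed by left
  -- multiplication by the generators of I, and these multiplications act by zero.
  have hdec : ModuleCat.ofHom g ≫ ModuleCat.ofHom I.subtype = ∑ i, pr i ≫ leftMulHom R (a i) := by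
    refine ModuleCat.hom_ext (LinearMap.ext fun x => ?_)
    have hx : g x = ∑ i, x i • g (Pi.single i 1) := by
      conv_lhs => rw [← Finset.univ_sum_single x]
      rw [map_sum]
      refine Finset.sum_congr rfl fun i _ => ?_
      rw [← map_smul, ← Pi.single_smul', smul_eq_mul, mul_one]
    rw [ModuleCat.hom_sum, LinearMap.sum_apply]
    change ((g x : I) : R) = ∑ i, a i * unop (x i)
    rw [hx, AddSubmonoidClass.coe_finsetSum]
    rfl
  have hcomp : ∀ i, Abelian.Ext.comp v (Abelian.Ext.mk₀ (pr i ≫ leftMulHom R (a i))) (add_zero n) =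
      0 := by
    intro i
    rw [← Abelian.Ext.mk₀_comp_mk₀, ← Abelian.Ext.comp_assoc_of_third_deg_zero]
    exact hkill (a i) (g (Pi.single i 1)).2 (v.comp (Abelian.Ext.mk₀ (pr i)) (add_zero n))
  have hassoc := Abelian.Ext.comp_assoc_of_third_deg_zero v (Abelian.Ext.mk₀ (ModuleCat.ofHom g))
    (Abelian.Ext.mk₀ (ModuleCat.ofHom I.subtype)) (add_zero n)
  refine hassoc.trans ?_
  rw [Abelian.Ext.mk₀_comp_mk₀, hdec, Abelian.Ext.mk₀_sum, Abelian.Ext.comp_sum]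
  exact Finset.sum_eq_zero fun i _ => hcomp i

/-- A criterion for `E_n(R_R)` not to be submodule-closed. -/
theorem not_submoduleClosed_extClass {R : Type u} [Ring R] [IsNoetherianRing R]
    [IsNoetherianRing Rᵐᵒᵖ] (n : ℕ) (I : Submodule Rᵐᵒᵖ R) (e : R) (hIe : ∀ s ∈ I, s * e = 0)
    (hpd : ∀ N : ModuleCat.{u} Rᵐᵒᵖ, HasProjectiveDimensionLE N (n + 1))
    (hinj : Module.Injective Rᵐᵒᵖ (R ⧸ I)) (N : ModuleCat.{u} Rᵐᵒᵖ) [Module.Finite Rᵐᵒᵖ N]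
    (y : ExtRegular R N (n + 1)) (hy : y ≠ 0) (hey : e • y = y) :
    ¬ SubmoduleClosed (ExtClass R (n + 1)) := by
  intro hclosed
  have hne : Submodule.span R {y} ≠ ⊥ := by simpa using hy
  obtain ⟨_, N', hN', ⟨φ⟩⟩ := hclosed (ModuleCat.of R (ExtRegular R N (n + 1)))
    ⟨finite_extRegular R N (n + 1), N, inferInstance, ⟨LinearEquiv.refl R _⟩⟩ (Submodule.span R {y})
    hne
  have hinj' : Injective (ModuleCat.of Rᵐᵒᵖ (R ⧸ I)) :=
    Module.injective_object_of_injective_module Rᵐᵒᵖ (R ⧸ I)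
  -- For s in I also s r lies in I, so s r y = s r e y = 0. Hence I kills R y and every module
  -- isomorphic to it.
  have hkill : ∀ s ∈ I, ∀ z : ExtRegular R N' (n + 1), s • z = 0 := by
    intro s hs z
    obtain ⟨⟨w, hw⟩, rfl⟩ := φ.surjective z
    obtain ⟨r, rfl⟩ := Submodule.mem_span_singleton.1 hw
    rw [← map_smul]
    have hsr : s * r ∈ I := I.smul_mem (op r) hs
    have h0 : s • r • y = 0 := by
      rw [← hey, smul_smul, smul_smul, hIe _ hsr, zero_smul]
    have h1 : (s • (⟨r • y, hw⟩ : Submodule.span R {y})) = 0 := Subtype.ext h0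
    exact (congrArg φ h1).trans (map_zero φ)
  have hzero := extRegular_eq_zero I N' (n + 1) (hpd N')
    (fun x => Abelian.Ext.eq_zero_of_injective x) hkill
  have h2 : (⟨y, Submodule.mem_span_singleton_self y⟩ : Submodule.span R {y}) = 0 :=
    φ.injective ((hzero _).trans (map_zero φ).symm)
  exact hy (congrArg Subtype.val h2)

end ExtClasses

/-! ### Coordinate models of the two algebras. -/

section Models

/-- The path algebra of `2 ⟵ 1 ⟶ 3` in coordinates; `xij` is the coefficient of the path from `j` to
`i`. -/
@[ext]
structure SpanModel (K : Type u) : Type u where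
  x11 : K
  x21 : K
  x31 : K
  x22 : K
  x33 : K

namespace SpanModel

variable {K : Type u} [Field K]

@[simps] instance : Zero (SpanModel K) := ⟨⟨0, 0, 0, 0, 0⟩⟩

@[simps] instance : One (SpanModel K) := ⟨⟨1, 0, 0, 1, 1⟩⟩

@[simps] instance : Add (SpanModel K) :=
  ⟨fun r s => ⟨r.x11 + s.x11, r.x21 + s.x21, r.x31 + s.x31, r.x22 + s.x22, r.x33 + s.x33⟩⟩

@[simps] instance : Neg (SpanModel K) :=
  ⟨fun r => ⟨-r.x11, -r.x21, -r.x31, -r.x22, -r.x33⟩⟩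

@[simps] instance : SMul K (SpanModel K) :=
  ⟨fun c r => ⟨c * r.x11, c * r.x21, c * r.x31, c * r.x22, c * r.x33⟩⟩

@[simps] instance : Mul (SpanModel K) :=
  ⟨fun r s => ⟨r.x11 * s.x11, r.x21 * s.x11 + r.x22 * s.x21, r.x31 * s.x11 + r.x33 * s.x31, r.x22 * s.x22, r.x33 * s.x33⟩⟩

instance : AddCommGroup (SpanModel K) where
  add_assoc r s t := by ext <;> simp [add_assoc]
  zero_add r := by ext <;> simp
  add_zero r := by ext <;> simp
  add_comm r s := by ext <;> simp [add_comm]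
  neg_add_cancel r := by ext <;> simp
  nsmul := nsmulRec
  zsmul := zsmulRec

instance : Ring (SpanModel K) where
  mul_assoc r s t := by ext <;> simp <;> ring
  one_mul r := by ext <;> simp
  mul_one r := by ext <;> simp
  left_distrib r s t := by ext <;> simp <;> ring
  right_distrib r s t := by ext <;> simp <;> ring
  zero_mul r := by ext <;> simp
  mul_zero r := by ext <;> simp
  neg_add_cancel r := by ext <;> simp
  zsmul := zsmulRec

instance : Module K (SpanModel K) where
  one_smul r := by ext <;> simp
  mul_smul c d r := by ext <;> simp [mul_assoc]
  smul_zero c := by ext <;> simp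
  smul_add c r s := by ext <;> simp [mul_add]
  add_smul c d r := by ext <;> simp [add_mul]
  zero_smul r := by ext <;> simp

instance : Algebra K (SpanModel K) :=
  Algebra.ofModule (fun c r s => by ext <;> simp <;> ring) (fun c r s => by ext <;> simp <;> ring)

theorem algebraMap_mul (c : K) (r : SpanModel K) : algebraMap K (SpanModel K) c * r = c • r := by
  rw [Algebra.algebraMap_eq_smul_one, smul_mul_assoc, one_mul]

/-- The character of the vertex `1`. -/
@[simps!] def char1 : SpanModel K →ₐ[K] K :=
  AlgHom.ofLinearMap { toFun := x11, map_add' := fun _ _ => rfl, map_smul' := fun _ _ => rfl } rfl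
    fun _ _ => rfl

/-- The character of the vertex `2`. -/
@[simps!] def char2 : SpanModel K →ₐ[K] K :=
  AlgHom.ofLinearMap { toFun := x22, map_add' := fun _ _ => rfl, map_smul' := fun _ _ => rfl } rfl
    fun _ _ => rfl

/-- The character of the vertex `3`. -/
@[simps!] def char3 : SpanModel K →ₐ[K] K :=
  AlgHom.ofLinearMap { toFun := x33, map_add' := fun _ _ => rfl, map_smul' := fun _ _ => rfl } rfl
    fun _ _ => rfl

end SpanModel

/-- The algebra `K Δ / (β α)` of the square quiver in coordinates; `xij` is the coefficient of the path
from `j` to `i` that is non-zero in the algebra. -/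
@[ext]
structure SquareModel (K : Type u) : Type u where
  x11 : K
  x21 : K
  x31 : K
  x41 : K
  x22 : K
  x42 : K
  x33 : K
  x43 : K
  x44 : K

namespace SquareModel

variable {K : Type u} [Field K]

@[simps] instance : Zero (SquareModel K) := ⟨⟨0, 0, 0, 0, 0, 0, 0, 0, 0⟩⟩

@[simps] instance : One (SquareModel K) := ⟨⟨1, 0, 0, 0, 1, 0, 1, 0, 1⟩⟩

@[simps] instance : Add (SquareModel K) :=
  ⟨fun r s => ⟨r.x11 + s.x11, r.x21 + s.x21, r.x31 + s.x31, r.x41 + s.x41, r.x22 + s.x22, r.x42 + s.x42, r.x33 + s.x33, r.x43 + s.x43, r.x44 + s.x44⟩⟩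

@[simps] instance : Neg (SquareModel K) :=
  ⟨fun r => ⟨-r.x11, -r.x21, -r.x31, -r.x41, -r.x22, -r.x42, -r.x33, -r.x43, -r.x44⟩⟩

@[simps] instance : SMul K (SquareModel K) :=
  ⟨fun c r => ⟨c * r.x11, c * r.x21, c * r.x31, c * r.x41, c * r.x22, c * r.x42, c * r.x33, c * r.x43, c * r.x44⟩⟩

@[simps] instance : Mul (SquareModel K) :=
  ⟨fun r s => ⟨r.x11 * s.x11, r.x21 * s.x11 + r.x22 * s.x21, r.x31 * s.x11 + r.x33 * s.x31, r.x41 * s.x11 + r.x43 * s.x31 + r.x44 * s.x41, r.x22 * s.x22, r.x42 * s.x22 + r.x44 * s.x42, r.x33 * s.x33, r.x43 * s.x33 + r.x44 * s.x43, r.x44 * s.x44⟩⟩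

instance : AddCommGroup (SquareModel K) where
  add_assoc r s t := by ext <;> simp [add_assoc]
  zero_add r := by ext <;> simp
  add_zero r := by ext <;> simp
  add_comm r s := by ext <;> simp [add_comm]
  neg_add_cancel r := by ext <;> simp
  nsmul := nsmulRec
  zsmul := zsmulRec

instance : Ring (SquareModel K) where
  mul_assoc r s t := by ext <;> simp <;> ring
  one_mul r := by ext <;> simp
  mul_one r := by ext <;> simp
  left_distrib r s t := by ext <;> simp <;> ring
  right_distrib r s t := by ext <;> simp <;> ring
  zero_mul r := by ext <;> simp
  mul_zero r := by ext <;> simp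
  neg_add_cancel r := by ext <;> simp
  zsmul := zsmulRec

instance : Module K (SquareModel K) where
  one_smul r := by ext <;> simp
  mul_smul c d r := by ext <;> simp [mul_assoc]
  smul_zero c := by ext <;> simp
  smul_add c r s := by ext <;> simp [mul_add]
  add_smul c d r := by ext <;> simp [add_mul]
  zero_smul r := by ext <;> simp

instance : Algebra K (SquareModel K) :=
  Algebra.ofModule (fun c r s => by ext <;> simp <;> ring) (fun c r s => by ext <;> simp <;> ring)

theorem algebraMap_mul (c : K) (r : SquareModel K) : algebraMap K (SquareModel K) c * r = c • r := by
  rw [Algebra.algebraMap_eq_smul_one, smul_mul_assoc, one_mul]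

/-- The character of the vertex `1`. -/
@[simps!] def char1 : SquareModel K →ₐ[K] K :=
  AlgHom.ofLinearMap { toFun := x11, map_add' := fun _ _ => rfl, map_smul' := fun _ _ => rfl } rfl
    fun _ _ => rfl

/-- The character of the vertex `2`. -/
@[simps!] def char2 : SquareModel K →ₐ[K] K :=
  AlgHom.ofLinearMap { toFun := x22, map_add' := fun _ _ => rfl, map_smul' := fun _ _ => rfl } rfl
    fun _ _ => rfl

/-- The character of the vertex `3`. -/
@[simps!] def char3 : SquareModel K →ₐ[K] K :=
  AlgHom.ofLinearMap { toFun := x33, map_add' := fun _ _ => rfl, map_smul' := fun _ _ => rfl } rfl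
    fun _ _ => rfl

/-- The character of the vertex `4`. -/
@[simps!] def char4 : SquareModel K →ₐ[K] K :=
  AlgHom.ofLinearMap { toFun := x44, map_add' := fun _ _ => rfl, map_smul' := fun _ _ => rfl } rfl
    fun _ _ => rfl

end SquareModel

end Models

/-! ### Global dimension of the two algebras. -/

section GlobalDimension

/-- The dual basis lemma: the data exhibit L as a direct summand of a finite free module. -/
theorem hasProjectiveDimensionLE_zero_of_generators {T : Type u} [Ring T] {L : Type u}
    [AddCommGroup L] [Module T L] {ι : Type} [Fintype ι] (a : ι → L) (s : ι → L →ₗ[T] T)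
    (h : ∀ x, ∑ i, s i x • a i = x) : HasProjectiveDimensionLE (ModuleCat.of T L) 0 := by
  classical
  have : Module.Projective T L := Module.Projective.of_split (LinearMap.pi s)
    (Fintype.linearCombination T a) (by ext x; simpa [Fintype.linearCombination_apply] using h x)
  exact (projective_iff_hasProjectiveDimensionLE_zero _).1 ((IsProjective.iff_projective L).1 this)

theorem hasProjectiveDimensionLE_of_forall_eq_zero {T : Type u} [Ring T] {M : Type u}
    [AddCommGroup M] [Module T M] (h : ∀ x : M, x = 0) (n : ℕ) :
    HasProjectiveDimensionLE (ModuleCat.of T M) n := by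
  have : Subsingleton M := ⟨fun x y => (h x).trans (h y).symm⟩
  have := (ModuleCat.isZero_of_subsingleton (ModuleCat.of T M)).hasProjectiveDimensionLT_zero
  exact hasProjectiveDimensionLT_of_ge _ 0 _ (Nat.zero_le _)

/-- A bound on the global dimension of a ring with a complete family of vertex idempotents, ordered
such that there are no paths to a vertex from a later one. -/
theorem hasProjectiveDimensionLE_of_vertices {K T : Type u} [Field K] [Ring T] [Algebra K T] {k : ℕ}
    (e : Fin k → T) (χ : Fin k → T →ₐ[K] K) (n : ℕ)
    (hχ : ∀ i, HasProjectiveDimensionLE (ModuleCat.of T (RingHom.ker (χ i))) n)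
    (hone : ∑ i, e i = 1) (hdiag : ∀ i t, e i * t * e i = algebraMap K T (χ i t) * e i)
    (hlt : ∀ i j, i < j → ∀ t, e i * t * e j = 0) (M : Type u) [AddCommGroup M] [Module T M] :
    HasProjectiveDimensionLE (ModuleCat.of T M) (n + 1) := by
  -- Induction on the number d of vertices where M may still be supported. The submodule killed by
  -- the next idempotent is supported on one vertex fewer.
  suffices h : ∀ d m, k = m + d → ∀ (M : Type u) [AddCommGroup M] [Module T M],
      (∀ (j : Fin k), j < m → ∀ x : M, e j • x = 0) →
        HasProjectiveDimensionLE (ModuleCat.of T M) (n + 1) from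
    h k 0 (zero_add k).symm M fun j hj => absurd hj (Nat.not_lt_zero _)
  intro d
  induction d with
  | zero =>
    intro m hm M _ _ hM
    refine hasProjectiveDimensionLE_of_forall_eq_zero (fun x => ?_) _
    rw [← one_smul T x, ← hone, Finset.sum_smul]
    exact Finset.sum_eq_zero fun j _ => hM j (by omega) x
  | succ d ih =>
    intro m hm M _ _ hM
    let i : Fin k := ⟨m, by omega⟩
    refine hasProjectiveDimensionLE_of_source (χ i) (e i) n (hχ i) M (fun t x => ?_) fun N hN =>
      ih (m + 1) (by omega) N fun j hj x => ?_
    · rw [← mul_smul (algebraMap K T _), ← hdiag, smul_smul]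
      -- Insert the sum of all idempotents in front of x: earlier ones kill M, and later ones are
      -- killed by e i t on the left.
      conv_lhs => rw [← one_smul T x, ← hone, Finset.sum_smul, Finset.smul_sum]
      rw [Finset.sum_eq_single i, smul_smul]
      · intro j _ hj
        rcases lt_or_gt_of_ne hj with h | h
        · rw [hM j h, smul_zero]
        · rw [smul_smul, hlt i j h, zero_smul]
      · simp
    · rcases Nat.lt_succ_iff_lt_or_eq.1 hj with h | h
      · exact Subtype.ext (hM j h x)
      · obtain rfl : j = i := Fin.ext h
        exact Subtype.ext (hN x x.2)

namespace SpanModel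

variable {K : Type u} [Field K]

theorem hasProjectiveDimensionLE_ker_char1 : HasProjectiveDimensionLE
    (ModuleCat.of (SpanModel K) (RingHom.ker (char1 (K := K)))) 0 := by
  refine hasProjectiveDimensionLE_zero_of_generators (ι := Fin 3)
    ![⟨⟨0, 0, 0, 1, 1⟩, rfl⟩, ⟨⟨0, 1, 0, 0, 0⟩, rfl⟩, ⟨⟨0, 0, 1, 0, 0⟩, rfl⟩]
    ![Submodule.subtype _,
      { toFun := fun x => ⟨0, 0, 0, x.1.x21, 0⟩
        map_add' := fun x y => by ext <;> simp
        map_smul' := fun r x => by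
          have hx : x.1.x11 = 0 := x.2
          ext <;> simp [hx] },
      { toFun := fun x => ⟨0, 0, 0, 0, x.1.x31⟩
        map_add' := fun x y => by ext <;> simp
        map_smul' := fun r x => by
          have hx : x.1.x11 = 0 := x.2
          ext <;> simp [hx] }] ?_
  intro x
  have hx : x.1.x11 = 0 := x.2
  simp only [Fin.sum_univ_three]
  ext <;> simp [hx]

theorem hasProjectiveDimensionLE_ker_char2 : HasProjectiveDimensionLE
    (ModuleCat.of (SpanModel K) (RingHom.ker (char2 (K := K)))) 0 := by
  refine hasProjectiveDimensionLE_zero_of_generators (ι := Unit)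
    (fun _ => ⟨⟨1, 0, 0, 0, 1⟩, rfl⟩) (fun _ => Submodule.subtype _) fun x => ?_
  have hx : x.1.x22 = 0 := x.2
  ext <;> simp [hx]

theorem hasProjectiveDimensionLE_ker_char3 : HasProjectiveDimensionLE
    (ModuleCat.of (SpanModel K) (RingHom.ker (char3 (K := K)))) 0 := by
  refine hasProjectiveDimensionLE_zero_of_generators (ι := Unit)
    (fun _ => ⟨⟨1, 0, 0, 1, 0⟩, rfl⟩) (fun _ => Submodule.subtype _) fun x => ?_
  have hx : x.1.x33 = 0 := x.2
  ext <;> simp [hx]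

/-- The algebra of the quiver `2 ⟵ 1 ⟶ 3` is left hereditary. -/
theorem hasProjectiveDimensionLE (M : Type u) [AddCommGroup M] [Module (SpanModel K) M] :
    HasProjectiveDimensionLE (ModuleCat.of (SpanModel K) M) 1 := by
  refine hasProjectiveDimensionLE_of_vertices
    ![⟨1, 0, 0, 0, 0⟩, ⟨0, 0, 0, 1, 0⟩, ⟨0, 0, 0, 0, 1⟩] ![char1, char2, char3] 0
    (by simpa [Fin.forall_fin_succ] using ⟨hasProjectiveDimensionLE_ker_char1,
      hasProjectiveDimensionLE_ker_char2, hasProjectiveDimensionLE_ker_char3⟩) ?_ ?_ ?_ M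
  · rw [Fin.sum_univ_three]; ext <;> simp
  · simp only [Fin.forall_fin_succ, algebraMap_mul]
    simp [SpanModel.ext_iff]
  · simp [Fin.forall_fin_succ, SpanModel.ext_iff]

/-- The character of `Kᵒᵖ`-algebra type attached to a character of an algebra. -/
abbrev opChar (χ : SpanModel K →ₐ[K] K) : (SpanModel K)ᵐᵒᵖ →ₐ[K] K :=
  χ.fromOpposite fun _ _ => mul_comm _ _

theorem hasProjectiveDimensionLE_ker_opChar1 : HasProjectiveDimensionLE
    (ModuleCat.of (SpanModel K)ᵐᵒᵖ (RingHom.ker (opChar (char1 (K := K))))) 0 := by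
  refine hasProjectiveDimensionLE_zero_of_generators (ι := Unit)
    (fun _ => ⟨op ⟨0, 0, 0, 1, 1⟩, rfl⟩) (fun _ => Submodule.subtype _) fun x => ?_
  have hx : x.1.unop.x11 = 0 := x.2
  refine Subtype.ext (unop_injective ?_)
  ext <;> simp [hx]

theorem hasProjectiveDimensionLE_ker_opChar2 : HasProjectiveDimensionLE
    (ModuleCat.of (SpanModel K)ᵐᵒᵖ (RingHom.ker (opChar (char2 (K := K))))) 0 := by
  refine hasProjectiveDimensionLE_zero_of_generators (ι := Fin 2)
    ![⟨op ⟨1, 0, 0, 0, 1⟩, rfl⟩, ⟨op ⟨0, 1, 0, 0, 0⟩, rfl⟩]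
    ![Submodule.subtype _,
      { toFun := fun x => op ⟨x.1.unop.x21, 0, 0, 0, 0⟩
        map_add' := fun x y => unop_injective (by ext <;> simp)
        map_smul' := fun r x => by
          have hx : x.1.unop.x22 = 0 := x.2
          refine unop_injective ?_
          ext <;> simp [hx] }] ?_
  intro x
  have hx : x.1.unop.x22 = 0 := x.2
  rw [Fin.sum_univ_two]
  refine Subtype.ext (unop_injective ?_)
  ext <;> simp [hx]

theorem hasProjectiveDimensionLE_ker_opChar3 : HasProjectiveDimensionLE
    (ModuleCat.of (SpanModel K)ᵐᵒᵖ (RingHom.ker (opChar (char3 (K := K))))) 0 := by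
  refine hasProjectiveDimensionLE_zero_of_generators (ι := Fin 2)
    ![⟨op ⟨1, 0, 0, 1, 0⟩, rfl⟩, ⟨op ⟨0, 0, 1, 0, 0⟩, rfl⟩]
    ![Submodule.subtype _,
      { toFun := fun x => op ⟨x.1.unop.x31, 0, 0, 0, 0⟩
        map_add' := fun x y => unop_injective (by ext <;> simp)
        map_smul' := fun r x => by
          have hx : x.1.unop.x33 = 0 := x.2
          refine unop_injective ?_
          ext <;> simp [hx] }] ?_
  intro x
  have hx : x.1.unop.x33 = 0 := x.2
  rw [Fin.sum_univ_two]
  refine Subtype.ext (unop_injective ?_)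
  ext <;> simp [hx]

/-- The algebra of the quiver `2 ⟵ 1 ⟶ 3` is right hereditary. -/
theorem hasProjectiveDimensionLE_op (M : Type u) [AddCommGroup M] [Module (SpanModel K)ᵐᵒᵖ M] :
    HasProjectiveDimensionLE (ModuleCat.of (SpanModel K)ᵐᵒᵖ M) 1 := by
  -- Arrows are reversed for right modules, so the vertices 2 and 3 now precede 1.
  refine hasProjectiveDimensionLE_of_vertices
    ![op ⟨0, 0, 0, 1, 0⟩, op ⟨0, 0, 0, 0, 1⟩, op ⟨1, 0, 0, 0, 0⟩]
    ![opChar char2, opChar char3, opChar char1] 0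
    (by simpa [Fin.forall_fin_succ] using ⟨hasProjectiveDimensionLE_ker_opChar2,
      hasProjectiveDimensionLE_ker_opChar3, hasProjectiveDimensionLE_ker_opChar1⟩) ?_ ?_ ?_ M
  · rw [Fin.sum_univ_three]; refine unop_injective ?_; ext <;> simp
  · simp only [Fin.forall_fin_succ, Algebra.algebraMap_eq_smul_one, smul_mul_assoc, one_mul]
    simp [← unop_inj, SpanModel.ext_iff]
    exact ⟨fun _ => rfl, fun _ => rfl, fun _ => rfl⟩
  · simp [Fin.forall_fin_succ, ← unop_inj, SpanModel.ext_iff]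

end SpanModel

namespace SquareModel

variable {K : Type u} [Field K]

theorem hasProjectiveDimensionLE_ker_char4 : HasProjectiveDimensionLE
    (ModuleCat.of (SquareModel K) (RingHom.ker (char4 (K := K)))) 0 := by
  refine hasProjectiveDimensionLE_zero_of_generators (ι := Unit)
    (fun _ => ⟨⟨1, 0, 0, 0, 1, 0, 1, 0, 0⟩, rfl⟩) (fun _ => Submodule.subtype _) fun x => ?_
  have hx : x.1.x44 = 0 := x.2
  ext <;> simp [hx]

theorem hasProjectiveDimensionLE_ker_char3 : HasProjectiveDimensionLE
    (ModuleCat.of (SquareModel K) (RingHom.ker (char3 (K := K)))) 0 := by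
  refine hasProjectiveDimensionLE_zero_of_generators (ι := Fin 2)
    ![⟨⟨1, 0, 0, 0, 1, 0, 0, 0, 1⟩, rfl⟩, ⟨⟨0, 0, 0, 0, 0, 0, 0, 1, 0⟩, rfl⟩]
    ![Submodule.subtype _,
      { toFun := fun x => ⟨0, 0, 0, 0, 0, 0, 0, 0, x.1.x43⟩
        map_add' := fun x y => by ext <;> simp
        map_smul' := fun r x => by
          have hx : x.1.x33 = 0 := x.2
          ext <;> simp [hx] }] ?_
  intro x
  have hx : x.1.x33 = 0 := x.2
  rw [Fin.sum_univ_two]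
  ext <;> simp [hx]

theorem hasProjectiveDimensionLE_ker_char2 : HasProjectiveDimensionLE
    (ModuleCat.of (SquareModel K) (RingHom.ker (char2 (K := K)))) 0 := by
  refine hasProjectiveDimensionLE_zero_of_generators (ι := Fin 2)
    ![⟨⟨1, 0, 0, 0, 0, 0, 1, 0, 1⟩, rfl⟩, ⟨⟨0, 0, 0, 0, 0, 1, 0, 0, 0⟩, rfl⟩]
    ![Submodule.subtype _,
      { toFun := fun x => ⟨0, 0, 0, 0, 0, 0, 0, 0, x.1.x42⟩
        map_add' := fun x y => by ext <;> simp
        map_smul' := fun r x => by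
          have hx : x.1.x22 = 0 := x.2
          ext <;> simp [hx] }] ?_
  intro x
  have hx : x.1.x22 = 0 := x.2
  rw [Fin.sum_univ_two]
  ext <;> simp [hx]

/-- The radical of R e₁ is S₂ ⊕ R e₃, the summands being generated by α and γ, since β α = 0.
Dropping the α-coordinate leaves a projective submodule; the quotient is supported at vertex 2,
where the character has projective kernel. -/
theorem hasProjectiveDimensionLE_ker_char1 : HasProjectiveDimensionLE
    (ModuleCat.of (SquareModel K) (RingHom.ker (char1 (K := K)))) 1 := by
  let N : Submodule (SquareModel K) (RingHom.ker (char1 (K := K))) :=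
    { carrier := {x | x.1.x21 = 0}
      add_mem' := fun {x y} hx hy => by
        rw [Set.mem_ofPred_eq] at *; simp [hx, hy]
      zero_mem' := rfl
      smul_mem' := fun r x hx => by
        have hx₁ : x.1.x11 = 0 := x.2
        rw [Set.mem_ofPred_eq] at *; simp [hx, hx₁] }
  refine hasProjectiveDimensionLE_of_submodule N 1 ?_ ?_
  · have h0 : HasProjectiveDimensionLE (ModuleCat.of (SquareModel K) N) 0 := by
      refine hasProjectiveDimensionLE_zero_of_generators (ι := Fin 2)
        ![⟨⟨⟨0, 0, 0, 0, 1, 0, 1, 0, 1⟩, rfl⟩, rfl⟩, ⟨⟨⟨0, 0, 1, 0, 0, 0, 0, 0, 0⟩, rfl⟩, rfl⟩]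
        ![Submodule.subtype _ ∘ₗ Submodule.subtype _,
          { toFun := fun x => ⟨0, 0, 0, 0, 0, 0, x.1.1.x31, x.1.1.x41, 0⟩
            map_add' := fun x y => by ext <;> simp
            map_smul' := fun r x => by
              have hx₁ : x.1.1.x11 = 0 := x.1.2
              ext <;> simp [hx₁] }] ?_
      intro x
      have hx₁ : x.1.1.x11 = 0 := x.1.2
      have hx : x.1.1.x21 = 0 := x.2
      rw [Fin.sum_univ_two]
      ext <;> simp [hx, hx₁]
    exact hasProjectiveDimensionLT_of_ge _ 1 _ one_le_two
  · refine hasProjectiveDimensionLE_of_character char2 0 hasProjectiveDimensionLE_ker_char2 _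
      fun t q => ?_
    obtain ⟨x, rfl⟩ := N.mkQ_surjective q
    rw [← map_smul, ← map_smul, ← sub_eq_zero, ← map_sub]
    refine (Submodule.Quotient.mk_eq_zero N).2 ?_
    have hx₁ : x.1.x11 = 0 := x.2
    change (t * x.1 - algebraMap K _ (char2 t) * x.1).x21 = 0
    rw [algebraMap_mul, sub_eq_add_neg]
    simp [hx₁]

/-- The algebra `K Δ / (β α)` has left global dimension at most two. -/
theorem hasProjectiveDimensionLE (M : Type u) [AddCommGroup M] [Module (SquareModel K) M] :
    HasProjectiveDimensionLE (ModuleCat.of (SquareModel K) M) 2 := by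
  have up : ∀ {X : ModuleCat.{u} (SquareModel K)}, HasProjectiveDimensionLE X 0 →
    HasProjectiveDimensionLE X 1 := fun h => hasProjectiveDimensionLT_of_ge _ 1 _ one_le_two
  refine hasProjectiveDimensionLE_of_vertices
    ![⟨1, 0, 0, 0, 0, 0, 0, 0, 0⟩, ⟨0, 0, 0, 0, 1, 0, 0, 0, 0⟩, ⟨0, 0, 0, 0, 0, 0, 1, 0, 0⟩,
      ⟨0, 0, 0, 0, 0, 0, 0, 0, 1⟩] ![char1, char2, char3, char4] 1
    (by simpa [Fin.forall_fin_succ] using ⟨hasProjectiveDimensionLE_ker_char1,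
      up hasProjectiveDimensionLE_ker_char2, up hasProjectiveDimensionLE_ker_char3,
      up hasProjectiveDimensionLE_ker_char4⟩) ?_ ?_ ?_ M
  · rw [Fin.sum_univ_four]; ext <;> simp
  · simp only [Fin.forall_fin_succ, algebraMap_mul]
    simp [SquareModel.ext_iff]
  · simp [Fin.forall_fin_succ, SquareModel.ext_iff]

/-- The exchange of the vertices `1` and `4`. -/
@[simps] def swap (r : SquareModel K) : SquareModel K :=
  ⟨r.x44, r.x42, r.x43, r.x41, r.x22, r.x21, r.x33, r.x31, r.x11⟩

theorem swap_mul (r s : SquareModel K) : swap (r * s) = swap s * swap r := by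
  ext <;> simp <;> ring

/-- The anti-automorphism of `K Δ / (β α)` that exchanges the vertices `1` and `4`. -/
def opEquiv : SquareModel K ≃ₐ[K] (SquareModel K)ᵐᵒᵖ where
  toFun r := op (swap r)
  invFun s := swap s.unop
  left_inv _ := rfl
  right_inv _ := rfl
  map_mul' r s := congrArg op (swap_mul r s)
  map_add' _ _ := rfl
  commutes' c := by
    rw [Algebra.algebraMap_eq_smul_one, Algebra.algebraMap_eq_smul_one]
    rfl

end SquareModel

end GlobalDimension

/-! ### Transport of global dimension along ring isomorphisms. -/

theorem hasProjectiveDimensionLE_of_ringEquiv {T S : Type u} [Ring T] [Ring S] (φ : T ≃+* S) (n : ℕ)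
    (h : ∀ (M : Type u) [AddCommGroup M] [Module S M],
      HasProjectiveDimensionLE (ModuleCat.of S M) n)
    (M : Type u) [AddCommGroup M] [Module T M] : HasProjectiveDimensionLE (ModuleCat.of T M) n := by
  let _ : Module S M := Module.compHom M φ.symm.toRingHom
  have := h M
  have := RingHomInvPair.of_ringEquiv φ.symm
  have : RingHomInvPair (φ.symm.symm : T →+* S) (φ.symm : S →+* T) := RingHomInvPair.symm _ _
  let e : ModuleCat.of S M ≃ₛₗ[RingHomClass.toRingHom φ.symm] ModuleCat.of T M :=
    { __ := AddEquiv.refl M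
      map_smul' := fun r x => rfl }
  exact ModuleCat.hasProjectiveDimensionLE_of_semiLinearEquiv φ.symm e n

/-! ### Algebra maps out of a path algebra. -/

namespace PathAlgebra

variable {K : Type u} [Field K] {V : Type} [Quiver.{0} V] {A : Type u} [Ring A] [Algebra K A]

/-- The product of the values of `F` along a path, starting from the value of `E` at its source. -/
def evalPath (E : V → A) (F : ∀ {a b : V}, (a ⟶ b) → A) {a : V} : ∀ {b : V}, Quiver.Path a b → A
  | _, .nil => E a
  | _, .cons p f => F f * evalPath E F p

theorem target_mul_evalPath (E : V → A) (F : ∀ {a b : V}, (a ⟶ b) → A) (hE : ∀ a, E a * E a = E a)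
    (hEF : ∀ {a b : V} (f : a ⟶ b), E b * F f = F f) {a b : V} (p : Quiver.Path a b) :
    E b * evalPath E F p = evalPath E F p := by
  cases p with
  | nil => exact hE _
  | cons p f => rw [evalPath, ← mul_assoc, hEF]

theorem evalPath_mul_source (E : V → A) (F : ∀ {a b : V}, (a ⟶ b) → A) (hE : ∀ a, E a * E a = E a)
    {a b : V} (p : Quiver.Path a b) : evalPath E F p * E a = evalPath E F p := by
  induction p with
  | nil => exact hE _
  | cons p f ih => rw [evalPath, mul_assoc, ih]

theorem evalPath_comp (E : V → A) (F : ∀ {a b : V}, (a ⟶ b) → A) (hE : ∀ a, E a * E a = E a)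
    (hEF : ∀ {a b : V} (f : a ⟶ b), E b * F f = F f)
    {a b c : V} (p : Quiver.Path a b) (q : Quiver.Path b c) :
    evalPath E F (p.comp q) = evalPath E F q * evalPath E F p := by
  induction q with
  | nil => exact (target_mul_evalPath E F hE hEF p).symm
  | cons q f ih => rw [Quiver.Path.comp_cons, evalPath, evalPath, ih, mul_assoc]

variable [DecidableEq V] [Fintype V]

/-- The algebra map out of a path algebra that is given by images of the vertices and the arrows. -/
noncomputable def liftHom (E : V → A) (F : ∀ {a b : V}, (a ⟶ b) → A) (hE : ∀ a, E a * E a = E a)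
    (hne : ∀ a b, a ≠ b → E b * E a = 0) (hone : ∑ a, E a = 1)
    (hEF : ∀ {a b : V} (f : a ⟶ b), E b * F f = F f) :
    PathAlgebra K V →ₐ[K] A :=
  let L : PathAlgebra K V →ₗ[K] A := Finsupp.lift A K (Σ a b : V, Quiver.Path a b)
    fun p => evalPath E F p.2.2
  have hL : ∀ {a b : V} (p : Quiver.Path a b), L (ofPath K p) = evalPath E F p :=
    fun p => lift_single _ _
  AlgHom.ofLinearMap L
    (by
      rw [one_def, map_sum, ← hone]
      exact Finset.sum_congr rfl fun a _ => hL _)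
    (fun x y => by
      have h : (mulBilin K V).compr₂ L = (LinearMap.mul K A).compl₁₂ L L := by
        refine hom_ext fun c d q => hom_ext fun a b p => ?_
        change L (ofPath K q * ofPath K p) = L (ofPath K q) * L (ofPath K p)
        rw [hL, hL]
        by_cases hbc : b = c
        · subst hbc
          rw [ofPath_mul_ofPath, hL, evalPath_comp E F hE hEF]
        -- For paths that do not compose, the idempotents at the source of q and the target of p are
        -- inserted; they are orthogonal.
        · rw [ofPath_mul_ofPath_of_ne _ _ hbc, map_zero, ← evalPath_mul_source E F hE q,
            ← target_mul_evalPath E F hE hEF p, mul_assoc, ← mul_assoc (E c), hne _ _ hbc, zero_mul,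
            mul_zero]
      exact congrArg (fun f => f x y) h)

end PathAlgebra

/-! ### Identification of the two algebras with their models. -/

section Coordinates

variable {K : Type u} [Field K]

/-- The images of the vertices in coordinates. -/
def SpanModel.vertex : SpanVertex → SpanModel K
  | .v1 => ⟨1, 0, 0, 0, 0⟩
  | .v2 => ⟨0, 0, 0, 1, 0⟩
  | .v3 => ⟨0, 0, 0, 0, 1⟩

/-- The images of the arrows in coordinates. -/
def SpanModel.arrow {a b : SpanVertex} : SpanArrow a b → SpanModel K
  | .toTwo => ⟨0, 1, 0, 0, 0⟩
  | .toThree => ⟨0, 0, 1, 0, 0⟩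

/-- The coordinates on the path algebra of `2 ⟵ 1 ⟶ 3`. -/
noncomputable def spanHom : SpanAlgebra K →ₐ[K] SpanModel K :=
  PathAlgebra.liftHom SpanModel.vertex SpanModel.arrow
    (fun a => by cases a <;> ext <;> simp [SpanModel.vertex])
    (fun a b h => by
      cases a <;> cases b <;> first | exact absurd rfl h | ext <;> simp [SpanModel.vertex])
    (by
      change SpanModel.vertex .v1 + (SpanModel.vertex .v2 + (SpanModel.vertex .v3 + 0)) = _
      ext <;> simp [SpanModel.vertex])
    (fun {a b} (f : SpanArrow a b) => by
      cases f <;> ext <;> simp [SpanModel.vertex, SpanModel.arrow])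

/-- The element of the path algebra of `2 ⟵ 1 ⟶ 3` with given coordinates. -/
noncomputable def spanInv : SpanModel K →ₗ[K] SpanAlgebra K where
  toFun x := x.x11 • PathAlgebra.ofPath K (Quiver.Path.nil (a := SpanVertex.v1)) +
    x.x21 • PathAlgebra.ofPath K (Quiver.Hom.toPath (V := SpanVertex) SpanArrow.toTwo) +
    x.x31 • PathAlgebra.ofPath K (Quiver.Hom.toPath (V := SpanVertex) SpanArrow.toThree) +
    x.x22 • PathAlgebra.ofPath K (Quiver.Path.nil (a := SpanVertex.v2)) +
    x.x33 • PathAlgebra.ofPath K (Quiver.Path.nil (a := SpanVertex.v3))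
  map_add' x y := by
    change (x.x11 + y.x11) • _ + (x.x21 + y.x21) • _ + (x.x31 + y.x31) • _ + (x.x22 + y.x22) • _ +
      (x.x33 + y.x33) • _ = _
    module
  map_smul' c x := by
    change (c * x.x11) • _ + (c * x.x21) • _ + (c * x.x31) • _ + (c * x.x22) • _ +
      (c * x.x33) • _ = _
    rw [RingHom.id_apply]
    module

theorem spanHom_ofPath {a b : SpanVertex} (p : Quiver.Path a b) :
    spanHom (PathAlgebra.ofPath K p) = PathAlgebra.evalPath SpanModel.vertex SpanModel.arrow p :=
  PathAlgebra.lift_single _ _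

theorem spanInv_spanHom (x : SpanAlgebra K) : spanInv (spanHom x) = x := by
  have h : spanInv ∘ₗ (spanHom (K := K)).toLinearMap = LinearMap.id := by
    refine PathAlgebra.hom_ext fun a b p => ?_
    change spanInv (spanHom _) = PathAlgebra.ofPath K p
    rw [spanHom_ofPath]
    cases p with
    | nil => cases a <;> simp [spanInv, PathAlgebra.evalPath, SpanModel.vertex]
    | @cons c _ p f =>
      change SpanArrow c b at f
      -- Both arrows start at vertex 1, where no arrow ends, so paths have length at most one.
      cases f <;> cases p with
      | nil =>
        simp [spanInv, PathAlgebra.evalPath, SpanModel.vertex, SpanModel.arrow, Quiver.Hom.toPath]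
      | @cons d _ p g =>
        change SpanArrow d .v1 at g
        cases g
  exact LinearMap.congr_fun h x

theorem spanHom_spanInv (x : SpanModel K) : spanHom (spanInv x) = x := by
  simp only [spanInv, LinearMap.coe_mk, AddHom.coe_mk, map_add, map_smul, spanHom_ofPath,
    Quiver.Hom.toPath, PathAlgebra.evalPath]
  ext <;> simp [SpanModel.vertex, SpanModel.arrow]

/-- The path algebra of `2 ⟵ 1 ⟶ 3` in coordinates. -/
noncomputable def spanEquiv : SpanAlgebra K ≃ₐ[K] SpanModel K :=
  { spanHom with
    invFun := spanInv
    left_inv := spanInv_spanHom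
    right_inv := spanHom_spanInv }

/-- The images of the vertices in coordinates. -/
def SquareModel.vertex : SquareVertex → SquareModel K
  | .v1 => ⟨1, 0, 0, 0, 0, 0, 0, 0, 0⟩
  | .v2 => ⟨0, 0, 0, 0, 1, 0, 0, 0, 0⟩
  | .v3 => ⟨0, 0, 0, 0, 0, 0, 1, 0, 0⟩
  | .v4 => ⟨0, 0, 0, 0, 0, 0, 0, 0, 1⟩

/-- The images of the arrows in coordinates. -/
def SquareModel.arrow {a b : SquareVertex} : SquareArrow a b → SquareModel K
  | .α => ⟨0, 1, 0, 0, 0, 0, 0, 0, 0⟩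
  | .β => ⟨0, 0, 0, 0, 0, 1, 0, 0, 0⟩
  | .γ => ⟨0, 0, 1, 0, 0, 0, 0, 0, 0⟩
  | .δ => ⟨0, 0, 0, 0, 0, 0, 0, 1, 0⟩

/-- The coordinates on the path algebra of the square quiver, modulo the relation. -/
noncomputable def squarePathHom : PathAlgebra K SquareVertex →ₐ[K] SquareModel K :=
  PathAlgebra.liftHom SquareModel.vertex SquareModel.arrow
    (fun a => by cases a <;> ext <;> simp [SquareModel.vertex])
    (fun a b h => by
      cases a <;> cases b <;> first | exact absurd rfl h | ext <;> simp [SquareModel.vertex])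
    (by
      change SquareModel.vertex .v1 + (SquareModel.vertex .v2 + (SquareModel.vertex .v3 +
        (SquareModel.vertex .v4 + 0))) = _
      ext <;> simp [SquareModel.vertex])
    (fun {a b} (f : SquareArrow a b) => by
      cases f <;> ext <;> simp [SquareModel.vertex, SquareModel.arrow])

theorem squarePathHom_ofPath {a b : SquareVertex} (p : Quiver.Path a b) :
    squarePathHom (PathAlgebra.ofPath K p) =
      PathAlgebra.evalPath SquareModel.vertex SquareModel.arrow p :=
  PathAlgebra.lift_single _ _

theorem squareRelation_eq : squareRelation K = PathAlgebra.ofPath K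
    ((Quiver.Hom.toPath (V := SquareVertex) SquareArrow.α).cons SquareArrow.β) :=
  PathAlgebra.ofPath_mul_ofPath _ _

theorem squareIdeal_le_ker :
    (squareIdeal K).ringCon ≤ RingCon.ker (squarePathHom (K := K)).toRingHom := by
  have h : squareIdeal K ≤ TwoSidedIdeal.ker (squarePathHom (K := K)).toRingHom := by
    refine TwoSidedIdeal.span_le.2 ?_
    rintro _ rfl
    rw [SetLike.mem_coe, TwoSidedIdeal.mem_ker, squareRelation_eq]
    refine (squarePathHom_ofPath _).trans ?_
    ext <;> simp [Quiver.Hom.toPath, PathAlgebra.evalPath, SquareModel.arrow, SquareModel.vertex]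
  intro x y hxy
  have h1 := h (((squareIdeal K).rel_iff x y).1 hxy)
  rw [TwoSidedIdeal.mem_ker, map_sub, sub_eq_zero] at h1
  exact h1

/-- The coordinates on `K Δ / (β α)`. -/
noncomputable def squareHom : SquareAlgebra K →ₐ[K] SquareModel K :=
  { (squareIdeal K).ringCon.lift (squarePathHom (K := K)).toRingHom squareIdeal_le_ker with
    commutes' := fun c => (squarePathHom (K := K)).commutes c }

variable (K) in
/-- The class of a path in `K Δ / (β α)`. -/
noncomputable def squarePath {a b : SquareVertex} (p : Quiver.Path a b) : SquareAlgebra K :=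
  (squareIdeal K).ringCon.mk' (PathAlgebra.ofPath K p)

theorem squareHom_squarePath {a b : SquareVertex} (p : Quiver.Path a b) :
    squareHom (squarePath K p) = PathAlgebra.evalPath SquareModel.vertex SquareModel.arrow p :=
  squarePathHom_ofPath p

theorem squarePath_relation : squarePath K
    ((Quiver.Hom.toPath (V := SquareVertex) SquareArrow.α).cons SquareArrow.β) = 0 := by
  have h : squareRelation K ∈ TwoSidedIdeal.ker (squareIdeal K).ringCon.mk' := by
    rw [TwoSidedIdeal.ker_ringCon_mk']
    exact TwoSidedIdeal.subset_span rfl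
  rw [TwoSidedIdeal.mem_ker, squareRelation_eq] at h
  exact h

/-- The element of `K Δ / (β α)` with given coordinates. -/
noncomputable def squareInv : SquareModel K →ₗ[K] SquareAlgebra K where
  toFun x := x.x11 • squarePath K (Quiver.Path.nil (a := SquareVertex.v1)) +
    x.x21 • squarePath K (Quiver.Hom.toPath (V := SquareVertex) SquareArrow.α) +
    x.x31 • squarePath K (Quiver.Hom.toPath (V := SquareVertex) SquareArrow.γ) +
    x.x41 • squarePath K
      ((Quiver.Hom.toPath (V := SquareVertex) SquareArrow.γ).cons SquareArrow.δ) +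
    x.x22 • squarePath K (Quiver.Path.nil (a := SquareVertex.v2)) +
    x.x42 • squarePath K (Quiver.Hom.toPath (V := SquareVertex) SquareArrow.β) +
    x.x33 • squarePath K (Quiver.Path.nil (a := SquareVertex.v3)) +
    x.x43 • squarePath K (Quiver.Hom.toPath (V := SquareVertex) SquareArrow.δ) +
    x.x44 • squarePath K (Quiver.Path.nil (a := SquareVertex.v4))
  map_add' x y := by
    change (x.x11 + y.x11) • _ + (x.x21 + y.x21) • _ + (x.x31 + y.x31) • _ + (x.x41 + y.x41) • _ +
      (x.x22 + y.x22) • _ + (x.x42 + y.x42) • _ + (x.x33 + y.x33) • _ + (x.x43 + y.x43) • _ +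
      (x.x44 + y.x44) • _ = _
    module
  map_smul' c x := by
    change (c * x.x11) • _ + (c * x.x21) • _ + (c * x.x31) • _ + (c * x.x41) • _ +
      (c * x.x22) • _ + (c * x.x42) • _ + (c * x.x33) • _ + (c * x.x43) • _ + (c * x.x44) • _ = _
    rw [RingHom.id_apply]
    module

theorem squareInv_squareHom (x : SquareAlgebra K) : squareInv (squareHom x) = x := by
  have h : squareInv ∘ₗ (squarePathHom (K := K)).toLinearMap =
      (RingCon.mkₐ K (squareIdeal K).ringCon).toLinearMap := by
    refine PathAlgebra.hom_ext fun a b p => ?_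
    change squareInv (squarePathHom _) = squarePath K p
    rw [squarePathHom_ofPath]
    cases p with
    | nil => cases a <;> simp [squareInv, PathAlgebra.evalPath, SquareModel.vertex]
    | @cons c _ p f =>
      change SquareArrow c b at f
      cases p with
      | nil =>
        cases f <;> simp [squareInv, PathAlgebra.evalPath, SquareModel.vertex, SquareModel.arrow,
          Quiver.Hom.toPath]
      | @cons d _ p g =>
        change SquareArrow d c at g
        cases p with
        | nil =>
          -- The paths of length two are β α and δ γ; the first has zero coordinates and is zero in
          -- the quotient by `h0`.
          have h0 := squarePath_relation (K := K)
          cases g <;> cases f <;> simp [squareInv, PathAlgebra.evalPath, SquareModel.vertex,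
            SquareModel.arrow, Quiver.Hom.toPath] at h0 ⊢
          exact h0.symm
        | @cons d' _ p g' =>
          change SquareArrow d' d at g'
          -- There are no paths of length three.
          cases g' <;> cases g <;> cases f
  obtain ⟨x, rfl⟩ := RingCon.mk'_surjective _ x
  exact LinearMap.congr_fun h x

theorem squareHom_squareInv (x : SquareModel K) : squareHom (squareInv x) = x := by
  simp only [squareInv, LinearMap.coe_mk, AddHom.coe_mk, map_add, map_smul, squareHom_squarePath,
    Quiver.Hom.toPath, PathAlgebra.evalPath]
  ext <;> simp [SquareModel.vertex, SquareModel.arrow]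

/-- The algebra `K Δ / (β α)` in coordinates. -/
noncomputable def squareEquiv : SquareAlgebra K ≃ₐ[K] SquareModel K :=
  { squareHom with
    invFun := squareInv
    left_inv := squareInv_squareHom
    right_inv := squareHom_squareInv }

end Coordinates

/-! ### From Ext classes and global dimension to the invariants. -/

section Applications

/-- The global dimension bounds the injective dimension from above, and one non-zero class in degree
n bounds it from below. -/
theorem injectiveDimension_eq_of_ext {T : Type u} [Ring T] (n : ℕ)
    (h : ∀ (M : Type u) [AddCommGroup M] [Module T M],
      HasProjectiveDimensionLE (ModuleCat.of T M) n) {N X : ModuleCat.{u} T} (x : Abelian.Ext N X n)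
    (hx : x ≠ 0) : injectiveDimension X = n := by
  refine le_antisymm ((injectiveDimension_le_iff X n).2 ?_) ((injectiveDimension_ge_iff X n).2 ?_)
  · refine HasInjectiveDimensionLT.mk fun i hi Y e => ?_
    have := h Y
    exact Abelian.Ext.eq_zero_of_hasProjectiveDimensionLT e (n + 1) hi
  · intro hlt
    exact hx (Abelian.Ext.eq_zero_of_hasInjectiveDimensionLT x n le_rfl)

/-- The lower bound needs only an embedding into an injective module; essentiality plays no role in
it. -/
theorem injectiveEnvelopeHasFlatDim {R : Type u} [Ring R] (M : Type u) [AddCommGroup M] [Module R M]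
    (n : ℕ) (h : ∀ (N : Type u) [AddCommGroup N] [Module R N],
      HasProjectiveDimensionLE (ModuleCat.of R N) n)
    (hlow : ∀ (E : Type u) [AddCommGroup E] [Module R E] (i : M →ₗ[R] E), Module.Injective R E →
      Function.Injective i → ∀ m < n, ¬ HasFlatDimLE R m E) :
    InjectiveEnvelopeHasFlatDim R M n :=
  ⟨exists_isInjectiveEnvelope M, fun E i hi => flatDim_eq_of_not
    (hasFlatDimLE_of_hasProjectiveDimensionLE n E (h E))
    (hlow E i hi.injective_module hi.injective)⟩

theorem isNoetherianRing_op_of_finite (K R : Type u) [Field K] [Ring R] [Algebra K R]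
    [Module.Finite K R] : IsNoetherianRing R ∧ IsNoetherianRing Rᵐᵒᵖ := by
  have : Module.Finite K Rᵐᵒᵖ := Module.Finite.equiv (MulOpposite.opLinearEquiv K)
  exact ⟨isNoetherian_of_tower K inferInstance, isNoetherian_of_tower K inferInstance⟩

/-- The elements of an injective module `E` that are reached from a left ideal `I` through a map. -/
theorem exists_smul_eq_of_injective {R E : Type u} [Ring R] [AddCommGroup E] [Module R E]
    (hE : Module.Injective R E) (I : Submodule R R) (g : I →ₗ[R] E) :
    ∃ m : E, ∀ t : I, (t : R) • m = g t := by
  obtain ⟨h, hh⟩ := hE.out I.subtype I.injective_subtype g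
  refine ⟨h 1, fun t => ?_⟩
  rw [← hh, ← map_smul]
  simp

/-- The quotient of the right regular module by the kernel of the character of a sink is
injective. -/
theorem module_injective_quotient_of_character {K R : Type u} [Field K] [Ring R] [Algebra K R]
    (χ : R →ₐ[K] K) (e : R) (he : χ e = 1) (het : ∀ t, t * e = algebraMap K R (χ t) * e)
    (I : Submodule Rᵐᵒᵖ R) (hI : ∀ r, r ∈ I ↔ χ r = 0) : Module.Injective Rᵐᵒᵖ (R ⧸ I) := by
  refine module_injective_of_character (χ.fromOpposite fun _ _ => mul_comm _ _) (op e) he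
    (fun t => ?_) (R ⧸ I) fun t x => ?_
  · refine unop_injective ((het t.unop).trans ?_)
    rw [Algebra.commutes]
    rfl
  · obtain ⟨r, rfl⟩ := I.mkQ_surjective x
    rw [← map_smul, ← map_smul, ← sub_eq_zero, ← map_sub]
    refine (Submodule.Quotient.mk_eq_zero I).2 ((hI _).2 ?_)
    change χ (r * t.unop - r * algebraMap K R (χ t.unop)) = 0
    rw [map_sub, map_mul, map_mul, χ.commutes]
    exact sub_self _

end Applications

/-! ### The quiver 2 ⟵ 1 ⟶ 3. -/

section Span

variable {K R : Type u} [Field K] [Ring R] [Algebra K R]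

instance : Module.Finite K (SpanModel K) :=
  Module.Finite.of_injective
    (show SpanModel K →ₗ[K] Fin 5 → K from
    { toFun := fun x => ![x.x11, x.x21, x.x31, x.x22, x.x33]
      map_add' := fun x y => by ext i; fin_cases i <;> rfl
      map_smul' := fun c x => by ext i; fin_cases i <;> rfl })
    (fun x y h => by
      have h0 := congrFun h 0
      have h1 := congrFun h 1
      have h2 := congrFun h 2
      have h3 := congrFun h 3
      have h4 := congrFun h 4
      exact SpanModel.ext h0 h1 h2 h3 h4)

theorem exists_left_ext_ne_zero_of_spanEquiv (φ : R ≃ₐ[K] SpanModel K) :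
    ∃ (N : ModuleCat.{u} R) (x : Abelian.Ext N (ModuleCat.of R R) 1), x ≠ 0 := by
  let I : Submodule R R :=
    { carrier := {t | (φ t).x11 = 0 ∧ (φ t).x22 = 0 ∧ (φ t).x33 = 0}
      add_mem' := fun {s t} hs ht => by
        rw [Set.mem_ofPred_eq] at *; simp [hs, ht]
      zero_mem' := by simp
      smul_mem' := fun r t ht => by
        rw [Set.mem_ofPred_eq] at *; simp [ht] }
  -- On the radical, h fixes the arrow to 2 and kills the arrow to 3. If h were right multiplication
  -- by y, the e₁-coefficient of y would be both 1 and 0.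
  let h : I →ₗ[R] R :=
    { toFun := fun t => φ.symm ⟨0, (φ t.1).x21, 0, 0, 0⟩
      map_add' := fun s t => φ.injective (by ext <;> simp)
      map_smul' := fun r t => φ.injective (by
        have ht := t.2.1
        ext <;> simp [ht]) }
  obtain ⟨ξ, hξ⟩ := exists_ext_one I
  refine ⟨_, ξ.comp (Abelian.Ext.mk₀ (ModuleCat.ofHom h)) (add_zero 1), fun h0 => ?_⟩
  obtain ⟨y, hy⟩ := hξ (ModuleCat.of R R) (ModuleCat.ofHom h) h0
  have h1 := hy ⟨φ.symm ⟨0, 1, 0, 0, 0⟩, by simp [I]⟩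
  have h2 := hy ⟨φ.symm ⟨0, 0, 1, 0, 0⟩, by simp [I]⟩
  have h3 : (φ y).x11 = 1 := by
    have := congrArg (fun r => (φ r).x21) h1
    simpa [h] using this.symm
  have h4 : (φ y).x11 = 0 := by
    have := congrArg (fun r => (φ r).x31) h2
    simpa [h] using this.symm
  exact one_ne_zero (h3.symm.trans h4)

theorem exists_right_ext_ne_zero_of_spanEquiv (φ : R ≃ₐ[K] SpanModel K) :
    ∃ (N : ModuleCat.{u} Rᵐᵒᵖ) (_ : Module.Finite Rᵐᵒᵖ N) (x : ExtRegular R N 1),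
      x ≠ 0 ∧ φ.symm ⟨0, 0, 0, 0, 1⟩ • x = x := by
  let I : Submodule Rᵐᵒᵖ Rᵐᵒᵖ :=
    { carrier := {t | (φ t.unop).x11 = 0 ∧ (φ t.unop).x22 = 0 ∧ (φ t.unop).x33 = 0}
      add_mem' := fun {s t} hs ht => by
        rw [Set.mem_ofPred_eq] at *; simp [hs, ht]
      zero_mem' := by simp
      smul_mem' := fun r t ht => by
        rw [Set.mem_ofPred_eq] at *; simp [ht] }
  -- h sends the arrow 1 ⟶ 2 to the arrow 1 ⟶ 3, which no left multiplication does. Its values lie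
  -- in e₃ R, so e₃ fixes the resulting class.
  let h : I →ₗ[Rᵐᵒᵖ] R :=
    { toFun := fun t => φ.symm ⟨0, 0, (φ t.1.unop).x21, 0, 0⟩
      map_add' := fun s t => φ.injective (by ext <;> simp)
      map_smul' := fun r t => φ.injective (by
        have ht := t.2.2.1
        ext <;> simp [ht]) }
  obtain ⟨ξ, hξ⟩ := exists_ext_one I
  refine ⟨_, inferInstanceAs (Module.Finite Rᵐᵒᵖ (Rᵐᵒᵖ ⧸ I)),
    ξ.comp (Abelian.Ext.mk₀ (ModuleCat.ofHom h)) (add_zero 1), fun h0 => ?_, ?_⟩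
  · obtain ⟨y, hy⟩ := hξ (ModuleCat.of Rᵐᵒᵖ R) (ModuleCat.ofHom h) h0
    have h1 := hy ⟨op (φ.symm ⟨0, 1, 0, 0, 0⟩), by simp [I]⟩
    have := congrArg (fun r => (φ r).x31) h1
    simp [h] at this
  · refine (Abelian.Ext.comp_assoc_of_third_deg_zero _ _ _ _).trans ?_
    rw [Abelian.Ext.mk₀_comp_mk₀]
    congr 2
    refine ModuleCat.hom_ext (LinearMap.ext fun t => φ.injective ?_)
    change φ (φ.symm ⟨0, 0, 0, 0, 1⟩ * φ.symm ⟨0, 0, (φ t.1.unop).x21, 0, 0⟩) =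
      φ (φ.symm ⟨0, 0, (φ t.1.unop).x21, 0, 0⟩)
    ext <;> simp

/-- Injectivity yields m that the arrow to 2 sends to x and the arrow to 3 kills. An r with (arrow
to 3) r = 0 satisfies e₁ r = 0, so in a flat module e₁ m = 0 and therefore x = 0. -/
theorem not_isFlatModule_of_spanEquiv (φ : R ≃ₐ[K] SpanModel K) {E : Type u} [AddCommGroup E]
    [Module R E] (hE : Module.Injective R E) (x : E) (hx0 : x ≠ 0)
    (hx : φ.symm ⟨0, 0, 0, 1, 0⟩ • x = x) : ¬ IsFlatModule R E := by
  intro hflat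
  let I : Submodule R R :=
    { carrier := {t | (φ t).x11 = 0 ∧ (φ t).x22 = 0 ∧ (φ t).x33 = 0}
      add_mem' := fun {s t} hs ht => by
        rw [Set.mem_ofPred_eq] at *; simp [hs, ht]
      zero_mem' := by simp
      smul_mem' := fun r t ht => by
        rw [Set.mem_ofPred_eq] at *; simp [ht] }
  let g : I →ₗ[R] E :=
    { toFun := fun t => φ.symm ⟨0, 0, 0, (φ t.1).x21, 0⟩ • x
      map_add' := fun s t => by
        rw [← add_smul]
        congr 1
        exact φ.injective (by ext <;> simp)
      map_smul' := fun r t => by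
        have ht := t.2.1
        conv_rhs => rw [RingHom.id_apply]
        rw [smul_smul]
        congr 1
        exact φ.injective (by ext <;> simp [ht]) }
  obtain ⟨m, hm⟩ := exists_smul_eq_of_injective hE I g
  have ha : φ.symm ⟨0, 1, 0, 0, 0⟩ • m = x := by
    rw [hm ⟨φ.symm ⟨0, 1, 0, 0, 0⟩, by simp [I]⟩]
    simpa [g] using hx
  have hb : φ.symm ⟨0, 0, 1, 0, 0⟩ • m = 0 := by
    rw [hm ⟨φ.symm ⟨0, 0, 1, 0, 0⟩, by simp [I]⟩]
    have : (⟨0, 0, 0, 0, 0⟩ : SpanModel K) = 0 := rfl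
    simp [g, this]
  refine hx0 ?_
  have h1 : φ.symm ⟨1, 0, 0, 0, 0⟩ • m = 0 := by
    refine AddSubgroup.closure_induction ?_ (smul_zero _) (fun y z _ _ hy hz => by
      rw [smul_add, hy, hz, add_zero]) (fun y _ hy => by rw [smul_neg, hy, neg_zero])
      (hflat.mem_closure_of_smul_eq_zero hb)
    rintro _ ⟨r, y, hr, rfl⟩
    have hr' : (φ r).x11 = 0 := by
      simpa using congrArg (fun s => (φ s).x31) hr
    have : φ.symm ⟨1, 0, 0, 0, 0⟩ * r = 0 := φ.injective (by ext <;> simp [hr'])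
    rw [smul_smul, this, zero_smul]
  have h2 : φ.symm ⟨0, 1, 0, 0, 0⟩ = φ.symm ⟨0, 1, 0, 0, 0⟩ * φ.symm ⟨1, 0, 0, 0, 0⟩ :=
    φ.injective (by ext <;> simp)
  rw [← ha, h2, mul_smul, h1, smul_zero]

theorem spanAlgebra_properties (K : Type u) [Field K] :
    Module.Finite K (SpanAlgebra K) ∧ IsIwanagaGorensteinOfDim (SpanAlgebra K) 1 ∧
      InjectiveEnvelopeHasFlatDim (SpanAlgebra K) (SpanAlgebra K) 1 ∧
      ¬ SubmoduleClosed (ExtClass (SpanAlgebra K) 1) := by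
  let φ := spanEquiv (K := K)
  have hfin : Module.Finite K (SpanAlgebra K) := Module.Finite.equiv φ.symm.toLinearEquiv
  obtain ⟨hl, hr⟩ := isNoetherianRing_op_of_finite K (SpanAlgebra K)
  have hpd := hasProjectiveDimensionLE_of_ringEquiv φ.toRingEquiv 1
    SpanModel.hasProjectiveDimensionLE
  have hpd' := hasProjectiveDimensionLE_of_ringEquiv (RingEquiv.op φ.toRingEquiv) 1
    SpanModel.hasProjectiveDimensionLE_op
  obtain ⟨N, x, hx⟩ := exists_left_ext_ne_zero_of_spanEquiv φ
  obtain ⟨N', _, x', hx', he⟩ := exists_right_ext_ne_zero_of_spanEquiv φ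
  refine ⟨hfin, ⟨hl, hr, injectiveDimension_eq_of_ext 1 hpd x hx,
    injectiveDimension_eq_of_ext 1 hpd' x' hx'⟩, ?_, ?_⟩
  · refine injectiveEnvelopeHasFlatDim _ 1 hpd fun E _ _ i hE hi m hm => ?_
    obtain rfl : m = 0 := by omega
    refine not_isFlatModule_of_spanEquiv φ hE (i (φ.symm ⟨0, 0, 0, 1, 0⟩)) ?_ ?_
    · rw [Ne, map_eq_zero_iff i hi]
      intro h
      simpa using congrArg (fun s => (φ s).x22) h
    · rw [← map_smul]
      congr 1
      exact φ.injective (by ext <;> simp)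
  -- Vertex 3 is a sink, so the one-dimensional right module R / I is injective.
  · let I : Submodule (SpanAlgebra K)ᵐᵒᵖ (SpanAlgebra K) :=
      { carrier := {t | (φ t).x33 = 0}
        add_mem' := fun {s t} hs ht => by
          rw [Set.mem_ofPred_eq] at *; simp [hs, ht]
        zero_mem' := by simp
        smul_mem' := fun r t ht => by
          rw [Set.mem_ofPred_eq] at *; simp [ht] }
    refine not_submoduleClosed_extClass 0 I (φ.symm ⟨0, 0, 0, 0, 1⟩) (fun s hs => ?_)
      (fun N => hpd' N) (module_injective_quotient_of_character
        ((SpanModel.char3 (K := K)).comp φ.toAlgHom) (φ.symm ⟨0, 0, 0, 0, 1⟩) ?_ (fun t => ?_) I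
        fun r => Iff.rfl) N' x' hx' he
    · have hs' : (φ s).x33 = 0 := hs
      exact φ.injective (by ext <;> simp [hs'])
    · simp
    · refine φ.injective ?_
      rw [map_mul, map_mul, φ.commutes, SpanModel.algebraMap_mul]
      ext <;> simp

end Span

/-! ### The square quiver with β α = 0. -/

section Square

variable {K R : Type u} [Field K] [Ring R] [Algebra K R]

instance : Module.Finite K (SquareModel K) :=
  Module.Finite.of_injective
    (show SquareModel K →ₗ[K] Fin 9 → K from
    { toFun := fun x => ![x.x11, x.x21, x.x31, x.x41, x.x22, x.x42, x.x33, x.x43, x.x44]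
      map_add' := fun x y => by ext i; fin_cases i <;> rfl
      map_smul' := fun c x => by ext i; fin_cases i <;> rfl })
    (fun x y h => by
      have h0 := congrFun h 0
      have h1 := congrFun h 1
      have h2 := congrFun h 2
      have h3 := congrFun h 3
      have h4 := congrFun h 4
      have h5 := congrFun h 5
      have h6 := congrFun h 6
      have h7 := congrFun h 7
      have h8 := congrFun h 8
      exact SquareModel.ext h0 h1 h2 h3 h4 h5 h6 h7 h8)

theorem exists_left_ext_ne_zero_of_squareEquiv (φ : R ≃ₐ[K] SquareModel K) :
    ∃ (N : ModuleCat.{u} R) (x : Abelian.Ext N (ModuleCat.of R R) 2), x ≠ 0 := by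
  let α := φ.symm ⟨0, 1, 0, 0, 0, 0, 0, 0, 0⟩
  have hker : ∀ t : R, t ∈ LinearMap.ker (LinearMap.toSpanSingleton R R α) ↔ (φ t).x22 = 0 := by
    intro t
    rw [LinearMap.mem_ker, LinearMap.toSpanSingleton_apply]
    refine ⟨fun h => by simpa [α] using congrArg (fun s => (φ s).x21) h, fun h => ?_⟩
    exact φ.injective (by ext <;> simp [α, h])
  -- The left annihilator of α contains β. The map h sends β to δ γ, whereas β y never has a δ
  -- γ-coefficient.
  let h : LinearMap.ker (LinearMap.toSpanSingleton R R α) →ₗ[R] R :=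
    { toFun := fun t => φ.symm ⟨0, 0, 0, (φ t.1).x42, 0, 0, 0, 0, 0⟩
      map_add' := fun s t => φ.injective (by ext <;> simp)
      map_smul' := fun r t => φ.injective (by
        have ht := (hker _).1 t.2
        ext <;> simp [ht]) }
  obtain ⟨ξ, hξ⟩ := exists_ext_two α
  refine ⟨_, ξ.comp (Abelian.Ext.mk₀ (ModuleCat.ofHom h)) (add_zero 2), fun h0 => ?_⟩
  obtain ⟨y, hy⟩ := hξ (ModuleCat.of R R) (ModuleCat.ofHom h) h0
  have h1 := hy ⟨φ.symm ⟨0, 0, 0, 0, 0, 1, 0, 0, 0⟩, (hker _).2 (by simp)⟩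
  have := congrArg (fun r => (φ r).x41) h1
  simp [h] at this

theorem exists_right_ext_ne_zero_of_squareEquiv (φ : R ≃ₐ[K] SquareModel K) :
    ∃ (N : ModuleCat.{u} Rᵐᵒᵖ) (_ : Module.Finite Rᵐᵒᵖ N) (x : ExtRegular R N 2),
      x ≠ 0 ∧ φ.symm ⟨0, 0, 0, 0, 0, 0, 0, 0, 1⟩ • x = x := by
  let β := op (φ.symm ⟨0, 0, 0, 0, 0, 1, 0, 0, 0⟩)
  have hker : ∀ t : Rᵐᵒᵖ, t ∈ LinearMap.ker (LinearMap.toSpanSingleton Rᵐᵒᵖ Rᵐᵒᵖ β) ↔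
      (φ t.unop).x22 = 0 := by
    intro t
    rw [LinearMap.mem_ker, LinearMap.toSpanSingleton_apply]
    refine ⟨fun h => by simpa [β] using congrArg (fun s => (φ (unop s)).x42) h, fun h => ?_⟩
    exact unop_injective (φ.injective (by ext <;> simp [β, h]))
  -- The mirror image: α lies in the right annihilator of β and goes to δ γ, which is not of the
  -- form y α. The values lie in e₄ R, so e₄ fixes the class.
  let h : LinearMap.ker (LinearMap.toSpanSingleton Rᵐᵒᵖ Rᵐᵒᵖ β) →ₗ[Rᵐᵒᵖ] R :=
    { toFun := fun t => φ.symm ⟨0, 0, 0, (φ t.1.unop).x21, 0, 0, 0, 0, 0⟩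
      map_add' := fun s t => φ.injective (by ext <;> simp)
      map_smul' := fun r t => φ.injective (by
        have ht := (hker _).1 t.2
        ext <;> simp [ht]) }
  obtain ⟨ξ, hξ⟩ := exists_ext_two β
  refine ⟨_, inferInstanceAs (Module.Finite Rᵐᵒᵖ
      (Rᵐᵒᵖ ⧸ LinearMap.range (LinearMap.toSpanSingleton Rᵐᵒᵖ Rᵐᵒᵖ β))),
    ξ.comp (Abelian.Ext.mk₀ (ModuleCat.ofHom h)) (add_zero 2), fun h0 => ?_, ?_⟩
  · obtain ⟨y, hy⟩ := hξ (ModuleCat.of Rᵐᵒᵖ R) (ModuleCat.ofHom h) h0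
    have h1 := hy ⟨op (φ.symm ⟨0, 1, 0, 0, 0, 0, 0, 0, 0⟩), (hker _).2 (by simp)⟩
    have := congrArg (fun r => (φ r).x41) h1
    simp [h] at this
  · refine (Abelian.Ext.comp_assoc_of_third_deg_zero _ _ _ _).trans ?_
    rw [Abelian.Ext.mk₀_comp_mk₀]
    congr 2
    refine ModuleCat.hom_ext (LinearMap.ext fun t => φ.injective ?_)
    change φ (φ.symm ⟨0, 0, 0, 0, 0, 0, 0, 0, 1⟩ *
        φ.symm ⟨0, 0, 0, (φ t.1.unop).x21, 0, 0, 0, 0, 0⟩) =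
      φ (φ.symm ⟨0, 0, 0, (φ t.1.unop).x21, 0, 0, 0, 0, 0⟩)
    ext <;> simp

/-- Any r with α r = 0 has zero coefficient at e₁, whence e₁ r = 0. -/
theorem IsFlatModule.vertex_one_smul_eq_zero (φ : R ≃ₐ[K] SquareModel K) {F : Type u}
    [AddCommGroup F] [Module R F] (hF : IsFlatModule R F) (x : F)
    (hx : φ.symm ⟨0, 1, 0, 0, 0, 0, 0, 0, 0⟩ • x = 0) :
    φ.symm ⟨1, 0, 0, 0, 0, 0, 0, 0, 0⟩ • x = 0 := by
  refine AddSubgroup.closure_induction ?_ (smul_zero _) (fun y z _ _ hy hz => by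
    rw [smul_add, hy, hz, add_zero]) (fun y _ hy => by rw [smul_neg, hy, neg_zero])
    (hF.mem_closure_of_smul_eq_zero hx)
  rintro _ ⟨r, y, hr, rfl⟩
  have hr' : (φ r).x11 = 0 := by
    simpa using congrArg (fun s => (φ s).x21) hr
  have : φ.symm ⟨1, 0, 0, 0, 0, 0, 0, 0, 0⟩ * r = 0 := φ.injective (by ext <;> simp [hr'])
  rw [smul_smul, this, zero_smul]

/-- If β r = 0, then e₂ r is a scalar multiple of α: the only relations on β come from β α = 0. -/
theorem IsFlatModule.exists_vertex_two_smul_eq (φ : R ≃ₐ[K] SquareModel K) {F : Type u}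
    [AddCommGroup F] [Module R F] (hF : IsFlatModule R F) (x : F)
    (hx : φ.symm ⟨0, 0, 0, 0, 0, 1, 0, 0, 0⟩ • x = 0) :
    ∃ y : F, φ.symm ⟨0, 0, 0, 0, 1, 0, 0, 0, 0⟩ • x =
      φ.symm ⟨0, 1, 0, 0, 0, 0, 0, 0, 0⟩ • y := by
  refine AddSubgroup.closure_induction
    (p := fun x _ => ∃ y : F, φ.symm ⟨0, 0, 0, 0, 1, 0, 0, 0, 0⟩ • x =
      φ.symm ⟨0, 1, 0, 0, 0, 0, 0, 0, 0⟩ • y) ?_ ⟨0, by simp⟩ ?_ ?_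
    (hF.mem_closure_of_smul_eq_zero hx)
  · rintro _ ⟨r, y, hr, rfl⟩
    have hr' : (φ r).x22 = 0 := by
      simpa using congrArg (fun s => (φ s).x42) hr
    refine ⟨φ.symm ⟨(φ r).x21, 0, 0, 0, 0, 0, 0, 0, 0⟩ • y, ?_⟩
    rw [smul_smul, smul_smul]
    congr 1
    exact φ.injective (by ext <;> simp [hr'])
  · rintro _ _ _ _ ⟨y, hy⟩ ⟨z, hz⟩
    exact ⟨y + z, by rw [smul_add, smul_add, hy, hz]⟩
  · rintro _ _ ⟨y, hy⟩
    exact ⟨-y, by rw [smul_neg, smul_neg, hy]⟩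

theorem exists_ne_zero_of_squareEquiv (φ : R ≃ₐ[K] SquareModel K) {E : Type u} [AddCommGroup E]
    [Module R E] (hE : Module.Injective R E) (x : E) (hx0 : x ≠ 0)
    (hx : φ.symm ⟨0, 0, 0, 0, 0, 0, 0, 0, 1⟩ • x = x) :
    ∃ m : E, m ≠ 0 ∧ φ.symm ⟨1, 0, 0, 0, 0, 0, 0, 0, 0⟩ • m = m ∧
      φ.symm ⟨0, 1, 0, 0, 0, 0, 0, 0, 0⟩ • m = 0 := by
  -- The left ideal spanned by α and δ γ. Mapping α to 0 and δ γ to x, and extending to R by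
  -- injectivity, gives an element whose e₁-part is the desired one.
  let I : Submodule R R :=
    { carrier := {t | (φ t).x11 = 0 ∧ (φ t).x31 = 0 ∧ (φ t).x22 = 0 ∧ (φ t).x42 = 0 ∧
        (φ t).x33 = 0 ∧ (φ t).x43 = 0 ∧ (φ t).x44 = 0}
      add_mem' := fun {s t} hs ht => by
        rw [Set.mem_ofPred_eq] at *; simp [hs, ht]
      zero_mem' := by simp
      smul_mem' := fun r t ht => by
        rw [Set.mem_ofPred_eq] at *; simp [ht] }
  let g : I →ₗ[R] E :=
    { toFun := fun t => φ.symm ⟨0, 0, 0, 0, 0, 0, 0, 0, (φ t.1).x41⟩ • x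
      map_add' := fun s t => by
        rw [← add_smul]
        congr 1
        exact φ.injective (by ext <;> simp)
      map_smul' := fun r t => by
        have h1 := t.2.1
        have h2 := t.2.2.1
        conv_rhs => rw [RingHom.id_apply]
        rw [smul_smul]
        congr 1
        exact φ.injective (by ext <;> simp [h1, h2]) }
  obtain ⟨m, hm⟩ := exists_smul_eq_of_injective hE I g
  have ha : φ.symm ⟨0, 1, 0, 0, 0, 0, 0, 0, 0⟩ • m = 0 := by
    rw [hm ⟨φ.symm ⟨0, 1, 0, 0, 0, 0, 0, 0, 0⟩, by simp [I]⟩]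
    have : (⟨0, 0, 0, 0, 0, 0, 0, 0, 0⟩ : SquareModel K) = 0 := rfl
    simp [g, this]
  have hb : φ.symm ⟨0, 0, 0, 1, 0, 0, 0, 0, 0⟩ • m = x := by
    rw [hm ⟨φ.symm ⟨0, 0, 0, 1, 0, 0, 0, 0, 0⟩, by simp [I]⟩]
    simpa [g] using hx
  refine ⟨φ.symm ⟨1, 0, 0, 0, 0, 0, 0, 0, 0⟩ • m, fun h => hx0 ?_, ?_, ?_⟩
  · have h1 : φ.symm ⟨0, 0, 0, 1, 0, 0, 0, 0, 0⟩ =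
        φ.symm ⟨0, 0, 0, 1, 0, 0, 0, 0, 0⟩ * φ.symm ⟨1, 0, 0, 0, 0, 0, 0, 0, 0⟩ :=
      φ.injective (by ext <;> simp)
    rw [← hb, h1, mul_smul, h, smul_zero]
  · rw [smul_smul]
    congr 1
    exact φ.injective (by ext <;> simp)
  · rw [← ha, smul_smul]
    congr 1
    exact φ.injective (by ext <;> simp)

/-- The element m at vertex 1 with α m = 0 already excludes flatness. In a flat resolution of length
one, lift m to f: then α f lies in the kernel and is killed by β, so flatness of the kernel gives α
f = α y with y in the kernel. Flatness of F yields e₁ (f - y) = 0, and applying p gives m = 0. -/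
theorem not_hasFlatDimLE_of_squareEquiv (φ : R ≃ₐ[K] SquareModel K) {E : Type u} [AddCommGroup E]
    [Module R E] (hE : Module.Injective R E) (x : E) (hx0 : x ≠ 0)
    (hx : φ.symm ⟨0, 0, 0, 0, 0, 0, 0, 0, 1⟩ • x = x) (n : ℕ) (hn : n < 2) :
    ¬ HasFlatDimLE R n E := by
  obtain ⟨m, hm0, hem, ham⟩ := exists_ne_zero_of_squareEquiv φ hE x hx0 hx
  obtain rfl | rfl : n = 0 ∨ n = 1 := by omega
  · intro h
    exact hm0 (hem.symm.trans (IsFlatModule.vertex_one_smul_eq_zero φ h m ham))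
  · rintro ⟨F, p, hF, hp, hker⟩
    obtain ⟨f, rfl⟩ := hp m
    let k : LinearMap.ker p := ⟨φ.symm ⟨0, 1, 0, 0, 0, 0, 0, 0, 0⟩ • f, by
      rw [LinearMap.mem_ker, map_smul, ham]⟩
    have hk : φ.symm ⟨0, 0, 0, 0, 0, 1, 0, 0, 0⟩ • k = 0 := by
      refine Subtype.ext ?_
      change φ.symm ⟨0, 0, 0, 0, 0, 1, 0, 0, 0⟩ • φ.symm ⟨0, 1, 0, 0, 0, 0, 0, 0, 0⟩ • f = 0
      have h1 : φ.symm ⟨0, 0, 0, 0, 0, 1, 0, 0, 0⟩ * φ.symm ⟨0, 1, 0, 0, 0, 0, 0, 0, 0⟩ = 0 :=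
        φ.injective (by ext <;> simp)
      rw [smul_smul, h1, zero_smul]
    obtain ⟨y, hy⟩ := IsFlatModule.exists_vertex_two_smul_eq φ hker k hk
    have hy' : φ.symm ⟨0, 0, 0, 0, 1, 0, 0, 0, 0⟩ • φ.symm ⟨0, 1, 0, 0, 0, 0, 0, 0, 0⟩ • f =
        φ.symm ⟨0, 1, 0, 0, 0, 0, 0, 0, 0⟩ • (y : F) := congrArg Subtype.val hy
    have h2 : φ.symm ⟨0, 0, 0, 0, 1, 0, 0, 0, 0⟩ * φ.symm ⟨0, 1, 0, 0, 0, 0, 0, 0, 0⟩ =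
        φ.symm ⟨0, 1, 0, 0, 0, 0, 0, 0, 0⟩ := φ.injective (by ext <;> simp)
    rw [smul_smul, h2, ← sub_eq_zero, ← smul_sub] at hy'
    have h3 := IsFlatModule.vertex_one_smul_eq_zero φ hF _ hy'
    have h4 := congrArg p h3
    rw [map_smul, map_sub, LinearMap.mem_ker.1 y.2, sub_zero, map_zero, hem] at h4
    exact hm0 h4

theorem squareAlgebra_properties (K : Type u) [Field K] :
    Module.Finite K (SquareAlgebra K) ∧ IsIwanagaGorensteinOfDim (SquareAlgebra K) 2 ∧
      InjectiveEnvelopeHasFlatDim (SquareAlgebra K) (squareP4 K) 2 ∧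
      InjectiveEnvelopeHasFlatDim (SquareAlgebra K) (SquareAlgebra K) 2 ∧
      ¬ SubmoduleClosed (ExtClass (SquareAlgebra K) 2) := by
  let φ := squareEquiv (K := K)
  have hfin : Module.Finite K (SquareAlgebra K) := Module.Finite.equiv φ.symm.toLinearEquiv
  obtain ⟨hl, hr⟩ := isNoetherianRing_op_of_finite K (SquareAlgebra K)
  have hpd := hasProjectiveDimensionLE_of_ringEquiv φ.toRingEquiv 2
    SquareModel.hasProjectiveDimensionLE
  -- The anti-automorphism exchanging the vertices 1 and 4 reduces right modules to left modules.
  have hpd' := hasProjectiveDimensionLE_of_ringEquiv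
    ((RingEquiv.op φ.toRingEquiv).trans SquareModel.opEquiv.symm.toRingEquiv) 2
    SquareModel.hasProjectiveDimensionLE
  obtain ⟨N, x, hx⟩ := exists_left_ext_ne_zero_of_squareEquiv φ
  obtain ⟨N', _, x', hx', he⟩ := exists_right_ext_ne_zero_of_squareEquiv φ
  let e : SquareAlgebra K := φ.symm ⟨0, 0, 0, 0, 0, 0, 0, 0, 1⟩
  have he0 : e ≠ 0 := fun h => by simpa [e] using congrArg (fun s => (φ s).x44) h
  have hee : e * e = e := φ.injective (by ext <;> simp [e])
  have heP : e ∈ squareP4 K := by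
    have : e = squarePath K (Quiver.Path.nil (a := SquareVertex.v4)) :=
      φ.symm_apply_eq.2 (squareHom_squarePath (Quiver.Path.nil (a := SquareVertex.v4))).symm
    rw [this]
    exact Submodule.subset_span rfl
  refine ⟨hfin, ⟨hl, hr, injectiveDimension_eq_of_ext 2 hpd x hx,
    injectiveDimension_eq_of_ext 2 hpd' x' hx'⟩, ?_, ?_, ?_⟩
  · refine injectiveEnvelopeHasFlatDim _ 2 hpd fun E _ _ i hE hi m hm => ?_
    refine not_hasFlatDimLE_of_squareEquiv φ hE (i ⟨e, heP⟩) ?_ ?_ m hm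
    · rw [Ne, map_eq_zero_iff i hi]
      exact fun h => he0 (congrArg Subtype.val h)
    · rw [← map_smul]
      exact congrArg i (Subtype.ext hee)
  · refine injectiveEnvelopeHasFlatDim _ 2 hpd fun E _ _ i hE hi m hm => ?_
    refine not_hasFlatDimLE_of_squareEquiv φ hE (i e) ?_ ?_ m hm
    · rw [Ne, map_eq_zero_iff i hi]
      exact he0
    · rw [← map_smul]
      exact congrArg i hee
  -- Vertex 4 is a sink, so the one-dimensional right module R / I is injective.
  · let I : Submodule (SquareAlgebra K)ᵐᵒᵖ (SquareAlgebra K) :=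
      { carrier := {t | (φ t).x44 = 0}
        add_mem' := fun {s t} hs ht => by
          rw [Set.mem_ofPred_eq] at *; simp [hs, ht]
        zero_mem' := by simp
        smul_mem' := fun r t ht => by
          rw [Set.mem_ofPred_eq] at *; simp [ht] }
    refine not_submoduleClosed_extClass 1 I e (fun s hs => ?_)
      (fun N => hpd' N) (module_injective_quotient_of_character
        ((SquareModel.char4 (K := K)).comp φ.toAlgHom) e ?_ (fun t => ?_) I
        fun r => Iff.rfl) N' x' hx' he
    · have hs' : (φ s).x44 = 0 := hs
      exact φ.injective (by ext <;> simp [e, hs'])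
    · simp [e]
    · refine φ.injective ?_
      rw [map_mul, map_mul, φ.commutes, SquareModel.algebraMap_mul]
      ext <;> simp [e]

end Square

/-! ### Conclusion. -/

theorem mainTheorem4 (K : Type u) [Field K] :
    (Module.Finite K (SpanAlgebra K) ∧
      IsIwanagaGorensteinOfDim (SpanAlgebra K) 1 ∧
      InjectiveEnvelopeHasFlatDim (SpanAlgebra K) (SpanAlgebra K) 1 ∧
      ¬ SubmoduleClosed (ExtClass (SpanAlgebra K) 1)) ∧
    (Module.Finite K (SquareAlgebra K) ∧
      IsIwanagaGorensteinOfDim (SquareAlgebra K) 2 ∧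
      InjectiveEnvelopeHasFlatDim (SquareAlgebra K) (squareP4 K) 2 ∧
      InjectiveEnvelopeHasFlatDim (SquareAlgebra K) (SquareAlgebra K) 2 ∧
      ¬ SubmoduleClosed (ExtClass (SquareAlgebra K) 2)) ∧
    ¬ AuslanderQuestion.{u} := by
  have h := spanAlgebra_properties K
  exact ⟨h, squareAlgebra_properties K, fun hq =>
    h.2.2.2 (hq (SpanAlgebra K) h.2.1.left_noetherian h.2.1.right_noetherian)⟩
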